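/- Let $F$ be a number field and $\ell$ a prime number. All places $\mathfrak p$ below are finite unless said otherwise; $p$ is the rational prime below $\mathfrak p$, $F_{\mathfrak p}$ is the completion, $v_{\mathfrak p}$ the normalized valuation, $f_{\mathfrak p}$ the residue degree, and $\operatorname{Log}_\ell:\mathbb Q_\ell^\times\to\mathbb Z_\ell$ is the Iwasawa logarithm ($\operatorname{Log}_\ell \ell=0$). *Degrees and valuations.* Let $\widehat{\mathbb Q}_p^c$ be the compositum of the cyclotomic $\mathbb Z_q$-extensions of $\mathbb Q_p$ over all primes $q$, let $\widetilde f_{\mathfrak p}=[F_{\mathfrak p}\cap\widehat{\mathbb Q}_p^c:\mathbb Q_p]$, and let $\deg_F\mathfrak p=\widetilde f_{\mathfrak p}\deg_\ell p$, where $\deg_\ell p=\operatorname{Log}_\ell p$ for $p\ne\ell$, $\deg_\ell \ell=\ell$ for $\ell\neq 2$, and $\deg_2 2=4$. Let $\mathcal R_{\mathfrak p}=\varprojlim_n F_{\mathfrak p}^\times/F_{\mathfrak p}^{\times\ell^n}$ (and likewise at the infinite places). The logarithmic valuation $\widetilde v_{\mathfrak p}$ on $\mathcal R_{\mathfrak p}$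 is the extension of $$\widetilde v_{\mathfrak p}(x)=-\frac{\operatorname{Log}_\ell(N_{F_{\mathfrak p}/\mathbb Q_\ell}(x))}{\deg_F\mathfrak p}\quad(\mathfrak p\mid\ell),\qquad \widetilde v_{\mathfrak p}(x)=-\frac{\operatorname{Log}_\ell\big((N\mathfrak p)^{-v_{\mathfrak p}(x)}\big)}{\deg_F\mathfrak p}=\lambda_{\mathfrak p}v_{\mathfrak p}(x)\quad(\mathfrak p\nmid\ell),$$ where $\lambda_{\mathfrak p}=f_{\mathfrak p}/\widetilde f_{\mathfrak p}$. *Logarithmic classes.* Let $\mathcal J_F$ be the restricted product of the $\mathcal R_{\mathfrak p}$ over all places with respect to the unit subgroups $\{v_{\mathfrak p}=0\}$, and let $\widetilde{\mathcal U}_F\subset\mathcal J_F$ be the group of idelic logarithmic units, i.e. the common kernel of all $\widetilde v_{\mathfrak p}$. The group of logarithmic divisors is $\mathcal D\ell_F=\mathcal J_F/\widetilde{\mathcal U}_F$; the degree of the class $\mathfrak d$ of $x=(x_{\mathfrak p})$ is $\deg_F\mathfrak d=\sum_{\mathfrak p}\widetilde v_{\mathfrak p}(x_{\mathfrak p})\deg_F\mathfrak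 p$, and $\widetilde{\mathcal D\ell}_F$ is the subgroup of degree $0$. Let $\mathcal R_F=\mathbb Z_\ell\otimes_{\mathbb Z}F^\times$, and let $\widetilde{\mathcal P\ell}_F$ be the image of the natural map $\operatorname{div}_F:\mathcal R_F\to\mathcal D\ell_F$. The logarithmic $\ell$-class group is $\widetilde{\mathcal C\ell}_F=\widetilde{\mathcal D\ell}_F/\widetilde{\mathcal P\ell}_F$. *Ideals.* Let $\mathcal Id_F=\{\mathfrak a=\prod_{\mathfrak p\nmid\ell}\mathfrak p^{\alpha_{\mathfrak p}}\}$ be the group of $\ell$-ideals (finite products, $\alpha_{\mathfrak p}\in\mathbb Z_\ell$), let $$\widetilde{\mathcal Id}_F=\Big\{\mathfrak a\in\mathcal Id_F:\ \sum_{\mathfrak p\nmid\ell}\lambda_{\mathfrak p}\alpha_{\mathfrak p}\deg_F\mathfrak p=0\Big\},\qquad \widetilde{\mathcal Pr}_F=\Big\{\prod_{\mathfrak p\nmid\ell}\mathfrak p^{v_{\mathfrak p}(a)}:\ a\in\mathcal R_F,\ \widetilde v_{\mathfrak p}(a)=0\ \ \forall\,\mathfrak p\mid\ell\Big\}.$$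 Then $\widetilde{\mathcal P\ell}_F\subseteq\widetilde{\mathcal D\ell}_F$, $\widetilde{\mathcal Pr}_F\subseteq\widetilde{\mathcal Id}_F$, and there is an isomorphism of $\mathbb Z_\ell$-modules $$\widetilde{\mathcal C\ell}_F\;\simeq\;\widetilde{\mathcal Id}_F/\widetilde{\mathcal Pr}_F,$$ under which the class of $\mathfrak a=\prod_{\mathfrak p\nmid\ell}\mathfrak p^{\alpha_{\mathfrak p}}$ corresponds to the class of the logarithmic divisor $\mathfrak d_F(\mathfrak a)$ with $\widetilde v_{\mathfrak p}(\mathfrak d_F(\mathfrak a))=\lambda_{\mathfrak p}\alpha_{\mathfrak p}$ for $\mathfrak p\nmid\ell$ and $\widetilde v_{\mathfrak p}(\mathfrak d_F(\mathfrak a))=0$ for $\mathfrak p\mid\ell$. -/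

import Mathlib

open NumberField IsDedekindDomain

noncomputable section

namespace LogClass

open Filter Topology
open scoped WithZero TensorProduct RestrictedProduct

section Compactification

/-! ## The `ℓ`-adic compactification of an abelian group -/

variable (ℓ : ℕ) [Fact ℓ.Prime]


/-- The `ℓ`-adic compactification `lim A / ℓ ^ n A` of an abelian group `A` (written additively). -/
def Hat (A : Type*) [AddCommGroup A] : Type _ := AdicCompletion (Ideal.span {(ℓ : ℤ)}) A

instance (A : Type*) [AddCommGroup A] : AddCommGroup (Hat ℓ A) :=
  inferInstanceAs (AddCommGroup (AdicCompletion (Ideal.span {(ℓ : ℤ)}) A))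

/-- Reduction `ℤ_ℓ → ℤ / (ℓ) ^ n`. -/
def redPow (n : ℕ) : ℤ_[ℓ] →+* ℤ ⧸ (Ideal.span {(ℓ : ℤ)} ^ n) :=
  (Ideal.quotEquivOfEq (by rw [Ideal.span_singleton_pow, Nat.cast_pow])).toRingHom.comp
    ((Int.quotientSpanNatEquivZMod (ℓ ^ n)).symm.toRingHom.comp (PadicInt.toZModPow n))

theorem redPow_eq_mk (n : ℕ) (z : ℤ_[ℓ]) (a : ℤ) (h : (ℓ : ℤ_[ℓ]) ^ n ∣ z - a) :
    redPow ℓ n z = Ideal.Quotient.mk _ a := by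
  have h1 : PadicInt.toZModPow n z = (a : ZMod (ℓ ^ n)) := by
    rw [← Ideal.mem_span_singleton, ← PadicInt.ker_toZModPow, RingHom.mem_ker, map_sub,
      map_intCast, sub_eq_zero] at h
    exact h
  simp [redPow, h1]

theorem exists_int (n : ℕ) (z : ℤ_[ℓ]) : ∃ a : ℤ, (ℓ : ℤ_[ℓ]) ^ n ∣ z - a := by
  refine ⟨(z.appr n : ℤ), ?_⟩
  have := PadicInt.appr_spec n z
  rw [Ideal.mem_span_singleton] at this
  exact_mod_cast this

theorem redPow_compat {m n : ℕ} (hle : m ≤ n) :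
    (Ideal.Quotient.factorPow (Ideal.span {(ℓ : ℤ)}) hle).comp (redPow ℓ n) = redPow ℓ m := by
  ext z
  obtain ⟨a, ha⟩ := exists_int ℓ n z
  rw [RingHom.comp_apply, redPow_eq_mk ℓ n z a ha,
    redPow_eq_mk ℓ m z a ((pow_dvd_pow _ hle).trans ha)]
  rfl

/-- The canonical ring homomorphism `ℤ_ℓ → lim ℤ / (ℓ) ^ n`. -/
def padicIntToAdic : ℤ_[ℓ] →+* AdicCompletion (Ideal.span {(ℓ : ℤ)}) ℤ :=
  AdicCompletion.liftRingHom _ (redPow ℓ) (redPow_compat ℓ)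

/-- The natural `ℤ_ℓ`-module structure on `lim A / ℓ ^ n A`: on the `n`-th component, `z` acts as
any integer congruent to `z` modulo `ℓ ^ n` (see `Hat.coord_smul`). -/
instance padicModule (A : Type*) [AddCommGroup A] : Module ℤ_[ℓ] (Hat ℓ A) :=
  letI : Module ℤ_[ℓ] (AdicCompletion (Ideal.span {(ℓ : ℤ)}) A) :=
    Module.compHom _ (padicIntToAdic ℓ)
  inferInstanceAs (Module ℤ_[ℓ] (AdicCompletion (Ideal.span {(ℓ : ℤ)}) A))

/-- The projection to the `n`-th component `A / ℓ ^ n A`. -/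
def Hat.coord {A : Type*} [AddCommGroup A] (n : ℕ) :
    Hat ℓ A →+ A ⧸ (Ideal.span {(ℓ : ℤ)} ^ n • ⊤ : Submodule ℤ A) :=
  (AdicCompletion.eval (Ideal.span {(ℓ : ℤ)}) A n).toAddMonoidHom

theorem Hat.coord_smul {A : Type*} [AddCommGroup A] (z : ℤ_[ℓ]) (x : Hat ℓ A) (n : ℕ) (a : ℤ)
    (h : (ℓ : ℤ_[ℓ]) ^ n ∣ z - a) : Hat.coord ℓ n (z • x) = a • Hat.coord ℓ n x := by
  have h1 := AdicCompletion.val_smul_eq_evalₐ_smul (Ideal.span {(ℓ : ℤ)}) (M := A) n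
    (padicIntToAdic ℓ z) (Hat.coord ℓ n x)
  rw [padicIntToAdic, AdicCompletion.evalₐ_liftRingHom _ _ (redPow_compat ℓ), redPow_eq_mk ℓ n z a h] at h1
  exact h1

instance : IsAdicComplete (Ideal.span {(ℓ : ℤ)}) ℤ_[ℓ] := by
  rw [← IsAdicComplete.map_algebraMap_iff (S := ℤ_[ℓ])]
  have : (Ideal.span {(ℓ : ℤ)}).map (algebraMap ℤ ℤ_[ℓ]) = IsLocalRing.maximalIdeal ℤ_[ℓ] := by
    rw [PadicInt.maximalIdeal_eq_span_p, Ideal.map_span]; simp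
  rw [this]; infer_instance

/-- The underlying function of `Hat.extend`. -/
def Hat.extendFun {A : Type*} [AddCommGroup A] (φ : A →+ ℤ_[ℓ]) (x : Hat ℓ A) : ℤ_[ℓ] :=
  (AdicCompletion.ofLinearEquiv (Ideal.span {(ℓ : ℤ)}) ℤ_[ℓ]).symm
    (AdicCompletion.map (Ideal.span {(ℓ : ℤ)}) φ.toIntLinearMap x)

theorem mk_eq_zero_of_dvd (n : ℕ) (y : ℤ_[ℓ]) (h : (ℓ : ℤ_[ℓ]) ^ n ∣ y) :
    y ∈ (Ideal.span {(ℓ : ℤ)} ^ n • ⊤ : Submodule ℤ ℤ_[ℓ]) := by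
  obtain ⟨c, rfl⟩ := h
  have := Submodule.smul_mem_smul (I := Ideal.span {(ℓ : ℤ)} ^ n) (r := (ℓ : ℤ) ^ n)
    (Ideal.pow_mem_pow (Ideal.mem_span_singleton_self _) n)
    (Submodule.mem_top (R := ℤ) (x := c))
  simpa [zsmul_eq_mul] using this

theorem Hat.mk_extendFun {A : Type*} [AddCommGroup A] (φ : A →+ ℤ_[ℓ]) (x : Hat ℓ A) (n : ℕ) :
    Submodule.Quotient.mk (Hat.extendFun ℓ φ x)
      = φ.toIntLinearMap.reduceModIdeal (Ideal.span {(ℓ : ℤ)} ^ n) (Hat.coord ℓ n x) := by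
  have h := AdicCompletion.of_ofLinearEquiv_symm (Ideal.span {(ℓ : ℤ)}) (M := ℤ_[ℓ])
    (AdicCompletion.map (Ideal.span {(ℓ : ℤ)}) φ.toIntLinearMap x)
  exact congrArg (fun y => AdicCompletion.eval _ _ n y) h

/-- The unique extension of a homomorphism `A → ℤ_ℓ` to `lim A / ℓ ^ n A`; see `Hat.extend_of` and
`Hat.mk_extendFun`. -/
def Hat.extend {A : Type*} [AddCommGroup A] (φ : A →+ ℤ_[ℓ]) : Hat ℓ A →ₗ[ℤ_[ℓ]] ℤ_[ℓ] where
  toFun := Hat.extendFun ℓ φ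
  map_add' x y := by
    exact (congrArg _ (map_add (AdicCompletion.map (Ideal.span {(ℓ : ℤ)}) φ.toIntLinearMap) x y)).trans
      (map_add _ _ _)
  map_smul' z x := by
    apply AdicCompletion.of_injective (Ideal.span {(ℓ : ℤ)}) (M := ℤ_[ℓ])
    ext n
    obtain ⟨a, ha⟩ := exists_int ℓ n z
    change Submodule.Quotient.mk _ = Submodule.Quotient.mk _
    rw [Hat.mk_extendFun, Hat.coord_smul ℓ z x n a ha, map_zsmul, ← Hat.mk_extendFun,
      ← Submodule.Quotient.mk_smul, Submodule.Quotient.eq]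
    apply mk_eq_zero_of_dvd
    rw [← dvd_neg, RingHom.id_apply, smul_eq_mul, zsmul_eq_mul, neg_sub, ← sub_mul]
    exact ha.mul_right _

/-- The canonical map `A → lim A / ℓ ^ n A`. -/
def Hat.of (A : Type*) [AddCommGroup A] : A →+ Hat ℓ A :=
  (AdicCompletion.of (Ideal.span {(ℓ : ℤ)}) A).toAddMonoidHom

theorem Hat.extend_of {A : Type*} [AddCommGroup A] (φ : A →+ ℤ_[ℓ]) (a : A) :
    Hat.extend ℓ φ (Hat.of ℓ A a) = φ a := by
  apply AdicCompletion.of_injective (Ideal.span {(ℓ : ℤ)}) (M := ℤ_[ℓ])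
  ext n
  exact Hat.mk_extendFun ℓ φ (Hat.of ℓ A a) n

end Compactification

section Logarithm

/-! ## The Iwasawa logarithm -/

variable (ℓ : ℕ) [Fact ℓ.Prime]

/-- The `ℓ`-adic logarithm series `log (1 + z) = ∑ (-1) ^ n z ^ (n + 1) / (n + 1)`, for `‖z‖ < 1`. -/
def padicLog (z : ℚ_[ℓ]) : ℚ_[ℓ] := ∑' n : ℕ, (-1) ^ n * z ^ (n + 1) / (n + 1)

/-- The unit part `x / ℓ ^ v(x)` of an `ℓ`-adic number. -/
def unitPart (x : ℚ_[ℓ]) : ℚ_[ℓ] := x * (ℓ : ℚ_[ℓ]) ^ (-x.valuation)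

/-- The Iwasawa logarithm `Log_ℓ`: the homomorphism on `ℚ_ℓˣ` with `Log_ℓ ℓ = 0` which is given by
the logarithm series on principal units. As `u ^ (ℓ - 1)` is a principal unit for every unit `u`,
`Log_ℓ x = log (u ^ (ℓ - 1)) / (ℓ - 1)` with `u` the unit part of `x`. -/
def iwasawaLog (x : ℚ_[ℓ]) : ℚ_[ℓ] :=
  padicLog ℓ (unitPart ℓ x ^ (ℓ - 1) - 1) / ((ℓ - 1 : ℕ) : ℚ_[ℓ])

theorem norm_inv_natCast_le (k : ℕ) (hk : k ≠ 0) : ‖((k : ℚ_[ℓ]))⁻¹‖ ≤ k := by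
  rw [norm_inv]
  have h2 : (ℓ : ℝ) ^ (padicValNat ℓ k) ≤ k := by
    exact_mod_cast Nat.le_of_dvd (Nat.pos_of_ne_zero hk) pow_padicValNat_dvd
  have h3 : ‖(k : ℚ_[ℓ])‖ = ((ℓ : ℝ) ^ (padicValNat ℓ k))⁻¹ := by
    rw [Padic.norm_eq_zpow_neg_valuation (by exact_mod_cast hk), Padic.valuation_natCast, zpow_neg,
      zpow_natCast]
  rw [h3, inv_inv]; exact h2

theorem tendsto_choose (k : ℕ) :
    Tendsto (fun n : ℕ => (((ℓ ^ n - 1).choose k : ℕ) : ℚ_[ℓ])) atTop (𝓝 ((-1) ^ k)) := by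
  induction k with
  | zero => simp
  | succ k ih =>
    have hN : Tendsto (fun n : ℕ => ((ℓ : ℚ_[ℓ]) ^ n)) atTop (𝓝 0) :=
      tendsto_pow_atTop_nhds_zero_of_norm_lt_one Padic.norm_p_lt_one
    have key : ∀ n : ℕ, (((ℓ ^ n - 1).choose (k + 1) : ℕ) : ℚ_[ℓ])
        = (ℓ : ℚ_[ℓ]) ^ n / (k + 1) * (((ℓ ^ n - 1).choose k : ℕ) : ℚ_[ℓ])
          - (((ℓ ^ n - 1).choose k : ℕ) : ℚ_[ℓ]) := by
      intro n
      have hpos : 0 < ℓ ^ n := pow_pos (Fact.out : ℓ.Prime).pos n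
      obtain ⟨m, hm⟩ : ∃ m, ℓ ^ n = m + 1 := ⟨ℓ ^ n - 1, by omega⟩
      have h1 := Nat.choose_succ_succ' m k
      have h2 := Nat.add_one_mul_choose_eq m k
      have hk : ((k : ℚ_[ℓ]) + 1) ≠ 0 := by exact_mod_cast Nat.succ_ne_zero k
      rw [hm, Nat.add_sub_cancel]
      have h3 : ((ℓ : ℚ_[ℓ]) ^ n) = m + 1 := by exact_mod_cast hm
      rw [h3]
      have h1' : (((m + 1).choose (k + 1) : ℕ) : ℚ_[ℓ]) = m.choose k + m.choose (k + 1) := by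
        exact_mod_cast h1
      have h2' : ((m : ℚ_[ℓ]) + 1) * m.choose k = ((m + 1).choose (k + 1) : ℕ) * (k + 1) := by
        exact_mod_cast h2
      field_simp
      rw [h1'] at h2'
      linear_combination -h2'
    simp_rw [key]
    have := ((hN.div_const ((k : ℚ_[ℓ]) + 1)).mul ih).sub ih
    simpa [pow_succ] using this

theorem tendsto_padicLog (z : ℚ_[ℓ]) (hz : ‖z‖ < 1) :
    Tendsto (fun n : ℕ => ((1 + z) ^ (ℓ ^ n) - 1) / (ℓ : ℚ_[ℓ]) ^ n) atTop (𝓝 (padicLog ℓ z)) := by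
  have hℓ : (ℓ : ℚ_[ℓ]) ≠ 0 := by exact_mod_cast (Fact.out : ℓ.Prime).ne_zero
  have hexp : ∀ n : ℕ, ((1 + z) ^ (ℓ ^ n) - 1) / (ℓ : ℚ_[ℓ]) ^ n
      = ∑' k : ℕ, (((ℓ ^ n - 1).choose k : ℕ) : ℚ_[ℓ]) * z ^ (k + 1) / (k + 1) := by
    intro n
    have hpos : 0 < ℓ ^ n := pow_pos (Fact.out : ℓ.Prime).pos n
    obtain ⟨m, hm⟩ : ∃ m, ℓ ^ n = m + 1 := ⟨ℓ ^ n - 1, by omega⟩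
    have h3 : ((ℓ : ℚ_[ℓ]) ^ n) = m + 1 := by exact_mod_cast hm
    have hm0 : ((m : ℚ_[ℓ]) + 1) ≠ 0 := by exact_mod_cast Nat.succ_ne_zero m
    rw [hm, Nat.add_sub_cancel, h3, tsum_eq_sum (s := Finset.range (m + 1))]
    · rw [add_comm 1 z, add_pow, Finset.sum_range_succ', div_eq_iff hm0, Finset.sum_mul]
      simp only [one_pow, mul_one, pow_zero, Nat.choose_zero_right, Nat.cast_one, add_sub_cancel_right]
      refine Finset.sum_congr rfl fun k _ => ?_
      have hk : ((k : ℚ_[ℓ]) + 1) ≠ 0 := by exact_mod_cast Nat.succ_ne_zero k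
      have h2' : ((m : ℚ_[ℓ]) + 1) * m.choose k = ((m + 1).choose (k + 1) : ℕ) * (k + 1) := by
        exact_mod_cast Nat.add_one_mul_choose_eq m k
      field_simp
      linear_combination -z ^ (k + 1) * h2'
    · intro k hk
      rw [Nat.choose_eq_zero_of_lt (by simpa using hk)]; simp
  simp_rw [hexp]
  refine tendsto_tsum_of_dominated_convergence (bound := fun k : ℕ => ((k + 1 : ℕ) : ℝ) * ‖z‖ ^ (k + 1))
    ?_ ?_ ?_
  · have := (summable_pow_mul_geometric_of_norm_lt_one 1 (r := ‖z‖) (by simpa using hz))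
    simp only [pow_one] at this
    exact (summable_nat_add_iff (f := fun k : ℕ => (k : ℝ) * ‖z‖ ^ k) 1).mpr this
  · intro k
    exact ((tendsto_choose ℓ k).mul_const _).div_const _
  · refine Eventually.of_forall fun n k => ?_
    rw [div_eq_mul_inv, norm_mul, norm_mul, norm_pow]
    have h1 : ‖(((ℓ ^ n - 1).choose k : ℕ) : ℚ_[ℓ])‖ ≤ 1 := by
      simpa using Padic.norm_int_le_one (p := ℓ) (((ℓ ^ n - 1).choose k : ℕ) : ℤ)
    have h2 := norm_inv_natCast_le ℓ (k + 1) (Nat.succ_ne_zero k)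
    push_cast at h2 ⊢
    rw [mul_comm]
    exact mul_le_mul h2 (mul_le_of_le_one_left (by positivity) h1) (by positivity) (by positivity)

theorem padicLog_mul (z w : ℚ_[ℓ]) (hz : ‖z‖ < 1) (hw : ‖w‖ < 1) :
    padicLog ℓ ((1 + z) * (1 + w) - 1) = padicLog ℓ z + padicLog ℓ w := by
  have hlt : ‖(1 + z) * (1 + w) - 1‖ < 1 := by
    have : (1 + z) * (1 + w) - 1 = z + (w + z * w) := by ring
    rw [this]
    refine (Padic.nonarchimedean _ _).trans_lt (max_lt hz ?_)
    refine (Padic.nonarchimedean _ _).trans_lt (max_lt hw ?_)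
    rw [norm_mul]
    exact mul_lt_one_of_nonneg_of_lt_one_left (norm_nonneg z) hz hw.le
  have hN : Tendsto (fun n : ℕ => ((ℓ : ℚ_[ℓ]) ^ n)) atTop (𝓝 0) :=
    tendsto_pow_atTop_nhds_zero_of_norm_lt_one Padic.norm_p_lt_one
  have hℓ : (ℓ : ℚ_[ℓ]) ≠ 0 := by exact_mod_cast (Fact.out : ℓ.Prime).ne_zero
  have h1 := tendsto_padicLog ℓ z hz
  have h2 := tendsto_padicLog ℓ w hw
  have h3 := (h1.add h2).add (hN.mul (h1.mul h2))
  rw [zero_mul, add_zero] at h3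
  refine tendsto_nhds_unique (tendsto_padicLog ℓ _ hlt) (h3.congr fun n => ?_)
  have : (ℓ : ℚ_[ℓ]) ^ n ≠ 0 := pow_ne_zero _ hℓ
  rw [add_sub_cancel, mul_pow]
  field_simp
  ring

theorem norm_padicLog_le (z : ℚ_[ℓ]) (hz : ‖z‖ < 1) : ‖padicLog ℓ z‖ ≤ 1 := by
  refine le_of_tendsto (tendsto_padicLog ℓ z hz).norm (Eventually.of_forall fun n => ?_)
  have hℓ : (ℓ : ℚ_[ℓ]) ≠ 0 := by exact_mod_cast (Fact.out : ℓ.Prime).ne_zero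
  set y : ℤ_[ℓ] := ⟨z, hz.le⟩ with hy
  have hd : (ℓ : ℤ_[ℓ]) ∣ (1 + y) - 1 := by
    rw [add_sub_cancel_left, ← PadicInt.norm_lt_one_iff_dvd]; exact hz
  obtain ⟨c, hc⟩ := (pow_dvd_pow _ (Nat.le_succ n)).trans (dvd_sub_pow_of_dvd_sub hd n)
  have hc' : (1 + z) ^ (ℓ ^ n) - 1 = (ℓ : ℚ_[ℓ]) ^ n * c := by
    have := congrArg (fun t : ℤ_[ℓ] => (t : ℚ_[ℓ])) hc
    push_cast at this
    rwa [one_pow] at this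
  rw [hc', mul_div_cancel_left₀ _ (pow_ne_zero _ hℓ)]
  exact c.2

theorem norm_unitPart (x : ℚ_[ℓ]) (hx : x ≠ 0) : ‖unitPart ℓ x‖ = 1 := by
  have hℓ : (ℓ : ℝ) ≠ 0 := by exact_mod_cast (Fact.out : ℓ.Prime).ne_zero
  rw [unitPart, norm_mul, Padic.norm_p_zpow, neg_neg, Padic.norm_eq_zpow_neg_valuation hx,
    ← zpow_add₀ hℓ]
  simp

theorem norm_unitPart_pow (x : ℚ_[ℓ]) (hx : x ≠ 0) : ‖unitPart ℓ x ^ (ℓ - 1) - 1‖ < 1 := by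
  set y : ℤ_[ℓ] := ⟨unitPart ℓ x, (norm_unitPart ℓ x hx).le⟩ with hy
  have hyn : ‖y‖ = 1 := norm_unitPart ℓ x hx
  have h1 : ‖y ^ (ℓ - 1) - 1‖ < 1 := by
    rw [PadicInt.norm_lt_one_iff_dvd, ← Ideal.mem_span_singleton, ← PadicInt.maximalIdeal_eq_span_p,
      ← PadicInt.ker_toZMod, RingHom.mem_ker, map_sub, map_pow, map_one, sub_eq_zero]
    apply ZMod.pow_card_sub_one_eq_one
    intro h
    rw [← RingHom.mem_ker, PadicInt.ker_toZMod, PadicInt.maximalIdeal_eq_span_p,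
      Ideal.mem_span_singleton, ← PadicInt.norm_lt_one_iff_dvd, hyn] at h
    exact lt_irrefl _ h
  exact_mod_cast h1

theorem iwasawaLog_mul (x y : ℚ_[ℓ]) (hx : x ≠ 0) (hy : y ≠ 0) :
    iwasawaLog ℓ (x * y) = iwasawaLog ℓ x + iwasawaLog ℓ y := by
  have hℓ : (ℓ : ℚ_[ℓ]) ≠ 0 := by exact_mod_cast (Fact.out : ℓ.Prime).ne_zero
  have hu : unitPart ℓ (x * y) = unitPart ℓ x * unitPart ℓ y := by
    rw [unitPart, unitPart, unitPart, Padic.valuation_mul hx hy, neg_add, zpow_add₀ hℓ]; ring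
  rw [iwasawaLog, iwasawaLog, iwasawaLog, ← add_div,
    ← padicLog_mul ℓ _ _ (norm_unitPart_pow ℓ x hx) (norm_unitPart_pow ℓ y hy), hu, mul_pow]
  congr 2; ring

theorem norm_iwasawaLog_le (x : ℚ_[ℓ]) (hx : x ≠ 0) : ‖iwasawaLog ℓ x‖ ≤ 1 := by
  have hp : ℓ.Prime := Fact.out
  have h : ‖((ℓ - 1 : ℕ) : ℚ_[ℓ])‖ = 1 := by
    rw [Padic.norm_natCast_eq_one_iff]
    exact (Nat.coprime_self_sub_right hp.one_lt.le).mpr (Nat.coprime_one_right _)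
  rw [iwasawaLog, norm_div, h, div_one]
  exact norm_padicLog_le ℓ _ (norm_unitPart_pow ℓ x hx)

/-- The Iwasawa logarithm as a homomorphism `ℚ_ℓˣ → ℤ_ℓ`. -/
def iwasawaLogHom : Additive ℚ_[ℓ]ˣ →+ ℤ_[ℓ] where
  toFun x := ⟨iwasawaLog ℓ (x.toMul : ℚ_[ℓ]), norm_iwasawaLog_le ℓ _ x.toMul.ne_zero⟩
  map_zero' := by
    apply Subtype.ext
    have := iwasawaLog_mul ℓ 1 1 one_ne_zero one_ne_zero
    simp at this ⊢
    exact this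
  map_add' x y := by
    apply Subtype.ext
    exact iwasawaLog_mul ℓ _ _ x.toMul.ne_zero y.toMul.ne_zero

end Logarithm

section Embedding

/-! ## Embeddings of `p`-adic fields into completions -/

variable {F : Type*} [Field F] [NumberField F]

/-- The embedding of `ℚ`, with its `p`-adic topology, into the completion `F_v`. -/
def ratToCompletion (p : ℕ) [Fact p.Prime] (v : HeightOneSpectrum (𝓞 F)) :
    WithVal (Rat.padicValuation p) →+* v.adicCompletion F :=
  (algebraMap ℚ (v.adicCompletion F)).comp (WithVal.equiv (Rat.padicValuation p)).toRingHom

theorem valued_rat (v : HeightOneSpectrum (𝓞 F)) (q : ℚ) :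
    Valued.v (algebraMap ℚ (v.adicCompletion F) q) = v.valuation F (q : F) := by
  rw [IsScalarTower.algebraMap_apply ℚ F (v.adicCompletion F)]
  exact HeightOneSpectrum.valuedAdicCompletion_eq_valuation' v _

theorem valuation_rat_le_one (p : ℕ) [Fact p.Prime] (v : HeightOneSpectrum (𝓞 F))
    (hp : (p : 𝓞 F) ∈ v.asIdeal) (q : ℚ) (hq : Rat.padicValuation p q ≤ 1) :
    v.valuation F (q : F) ≤ 1 := by
  rw [Rat.padicValuation_le_one_iff] at hq
  have hden : (q.den : 𝓞 F) ∉ v.asIdeal := by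
    intro h
    apply v.isPrime.ne_top
    rw [Ideal.eq_top_iff_one]
    have hc : IsCoprime (p : ℤ) (q.den : ℤ) :=
      Nat.isCoprime_iff_coprime.mpr (((Fact.out : p.Prime).coprime_iff_not_dvd).mpr hq)
    obtain ⟨a, b, hab⟩ := hc
    have h1 : (a : 𝓞 F) * p + b * q.den = 1 := by exact_mod_cast congrArg (Int.cast (R := 𝓞 F)) hab
    rw [← h1]
    exact v.asIdeal.add_mem (v.asIdeal.mul_mem_left _ hp) (v.asIdeal.mul_mem_left _ h)
  have h1 : v.valuation F (q.den : F) = 1 := by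
    have := (v.valuation_eq_one_iff_notMem (K := F)).mpr hden
    simpa using this
  have h2 : v.valuation F (q.num : F) ≤ 1 := by
    have := v.valuation_le_one (K := F) (q.num : 𝓞 F)
    simpa using this
  rw [Rat.cast_def, map_div₀, h1, div_one]
  exact h2

theorem continuous_ratToCompletion (p : ℕ) [Fact p.Prime] (v : HeightOneSpectrum (𝓞 F))
    (hp : (p : 𝓞 F) ∈ v.asIdeal) : Continuous (ratToCompletion p v) := by
  apply continuous_of_continuousAt_zero (ratToCompletion p v)
  rw [ContinuousAt, map_zero]
  intro s hs
  obtain ⟨γ, hγ⟩ := Valued.mem_nhds_zero.mp hs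
  have hγ0 : MonoidWithZeroHom.ValueGroup₀.embedding γ.1 ≠ 0 :=
    MonoidWithZeroHom.ValueGroup₀.embedding_unit_ne_zero γ
  obtain ⟨n, hn⟩ : ∃ n : ℕ, WithZero.exp (-(n : ℤ))
      < MonoidWithZeroHom.ValueGroup₀.embedding γ.1 := by
    refine ⟨(WithZero.log (MonoidWithZeroHom.ValueGroup₀.embedding γ.1)).natAbs + 1, ?_⟩
    rw [← WithZero.lt_log_iff_exp_lt hγ0]
    have := neg_abs_le (WithZero.log (MonoidWithZeroHom.ValueGroup₀.embedding γ.1))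
    push_cast
    linarith
  have hp0 : (p : ℚ) ≠ 0 := by exact_mod_cast (Fact.out : p.Prime).ne_zero
  rw [mem_map, Valued.mem_nhds_zero]
  have hpn : Valued.v ((WithVal.equiv (Rat.padicValuation p)).symm ((p : ℚ) ^ n))
      = WithZero.exp (-(n : ℤ)) := by
    change Rat.padicValuation p ((p : ℚ) ^ n) = _
    rw [map_pow, Rat.padicValuation_self, ← WithZero.exp_nsmul]; simp
  refine ⟨Units.mk0 (Valued.v.restrict ((WithVal.equiv (Rat.padicValuation p)).symm ((p : ℚ) ^ n)))
    ?_, fun x hx => hγ ?_⟩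
  · rw [ne_eq, Valuation.restrict_eq_zero_iff, hpn]; exact WithZero.exp_ne_zero
  · simp only [Set.mem_ofPred_eq, Units.val_mk0, Valuation.restrict_lt_iff, hpn] at hx
    simp only [Set.mem_ofPred_eq, Valuation.restrict_lt_iff_lt_embedding]
    refine lt_of_le_of_lt ?_ hn
    set q : ℚ := WithVal.equiv _ x with hq
    change Rat.padicValuation p q < _ at hx
    change Valued.v (algebraMap ℚ (v.adicCompletion F) q) ≤ _
    rw [valued_rat]
    have hr : Rat.padicValuation p (q / (p : ℚ) ^ n) ≤ 1 := by
      rw [map_div₀, map_pow, Rat.padicValuation_self, ← WithZero.exp_nsmul]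
      refine div_le_one_of_le₀ (by simpa using hx.le) zero_le
    have h1 := valuation_rat_le_one p v hp _ hr
    have h2 : v.valuation F (p : F) ≤ WithZero.exp (-1) := by
      have := (v.valuation_lt_one_iff_mem (K := F) (p : 𝓞 F)).mpr hp
      simp only [map_natCast] at this
      have hpF : v.valuation F (p : F) ≠ 0 := by
        rw [Valuation.ne_zero_iff]; exact_mod_cast (Fact.out : p.Prime).ne_zero
      rw [← WithZero.log_le_iff_le_exp hpF]
      have h4 : WithZero.log (v.valuation F (p : F)) < 0 := by
        rw [WithZero.log_lt_iff_lt_exp hpF]; simpa using this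
      omega
    have h3 : (q : F) = ((q / (p : ℚ) ^ n : ℚ) : F) * (p : F) ^ n := by
      push_cast
      rw [div_mul_cancel₀]
      exact pow_ne_zero _ (by exact_mod_cast hp0)
    rw [h3, map_mul, map_pow]
    calc _ ≤ 1 * (WithZero.exp (-1 : ℤ)) ^ n := by gcongr
      _ = _ := by rw [one_mul, ← WithZero.exp_nsmul]; simp

/-- For a place `v` above `p`, the canonical embedding `ℚ_p → F_v`, i.e. the continuous extension
of `ℚ → F_v`. -/
def padicToCompletion (p : ℕ) [Fact p.Prime] (v : HeightOneSpectrum (𝓞 F))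
    (hp : (p : 𝓞 F) ∈ v.asIdeal) : ℚ_[p] →+* v.adicCompletion F :=
  (UniformSpace.Completion.extensionHom (ratToCompletion p v)
    (continuous_ratToCompletion p v hp)).comp (Padic.withValRingEquiv (p := p)).symm.toRingHom

end Embedding

section Global

/-! ## Places -/

variable {F : Type*} [Field F] [NumberField F]

/-- The rational prime below `v`. -/
def residueChar (v : HeightOneSpectrum (𝓞 F)) : ℕ :=
  Ideal.absNorm (v.asIdeal.under ℤ)

instance (v : HeightOneSpectrum (𝓞 F)) : Fact (residueChar v).Prime :=
  haveI : NeZero v.asIdeal := ⟨v.ne_bot⟩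
  haveI := v.isPrime
  ⟨Nat.absNorm_under_prime v.asIdeal⟩

theorem residueChar_mem (v : HeightOneSpectrum (𝓞 F)) : (residueChar v : 𝓞 F) ∈ v.asIdeal :=
  Int.absNorm_under_mem v.asIdeal

/-- The field `K(μ_{q^∞})` inside `Ω`. -/
def cyclotomicTower (K Ω : Type*) [Field K] [Field Ω] [Algebra K Ω] (q : ℕ) :
    IntermediateField K Ω :=
  IntermediateField.adjoin K {ζ : Ω | ∃ n : ℕ, ζ ^ q ^ n = 1}

/-- The cyclotomic `ℤ_q`-extension of `K` inside `Ω`: the subfield of `K(μ_{q^∞})` fixed by the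
torsion of the Galois group of `K(μ_{q^∞})` over `K`. -/
def cyclotomicZq (K Ω : Type*) [Field K] [Field Ω] [Algebra K Ω] (q : ℕ) : IntermediateField K Ω :=
  IntermediateField.lift (IntermediateField.fixedField (Subgroup.closure
    {σ : cyclotomicTower K Ω q ≃ₐ[K] cyclotomicTower K Ω q | IsOfFinOrder σ}))

/-- The cyclotomic `ℤ^`-extension of `K` inside `Ω`: the compositum of the cyclotomic
`ℤ_q`-extensions over all primes `q`. -/
def cyclotomicZHat (K Ω : Type*) [Field K] [Field Ω] [Algebra K Ω] : IntermediateField K Ω :=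
  ⨆ q : Nat.Primes, cyclotomicZq K Ω q

/-- The logarithmic inertia degree `[L ∩ K^c : K]`, where `K^c` is the cyclotomic `ℤ^`-extension of
`K`, and the intersection is taken inside an algebraic closure of `L`. -/
def localLogInertiaDeg (K L : Type*) [Field K] [Field L] [Algebra K L] : ℕ :=
  Module.finrank K ↥((IsScalarTower.toAlgHom K L (AlgebraicClosure L)).fieldRange ⊓
    cyclotomicZHat K (AlgebraicClosure L))

/-- The absolute logarithmic inertia degree `f~_v = [F_v ∩ ℚ_p^c : ℚ_p]` of a finite place `v ∣ p`. -/
def logInertiaDeg (v : HeightOneSpectrum (𝓞 F)) : ℕ :=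
  letI := (padicToCompletion (residueChar v) v (residueChar_mem v)).toAlgebra
  localLogInertiaDeg ℚ_[residueChar v] (v.adicCompletion F)

variable (ℓ : ℕ) [Fact ℓ.Prime]

/-- The degree `deg_ℓ p`: it is `Log_ℓ p` for `p ≠ ℓ`, it is `ℓ` for `p = ℓ ≠ 2`, and `4` for
`p = ℓ = 2`. -/
def rationalDegree (p : ℕ) : ℚ_[ℓ] :=
  if p = ℓ then (if ℓ = 2 then 4 else (ℓ : ℚ_[ℓ])) else iwasawaLog ℓ (p : ℚ_[ℓ])

/-- The `ℓ`-adic degree `deg_F v = f~_v deg_ℓ p` of a finite place `v ∣ p`. -/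
def placeDegree (v : HeightOneSpectrum (𝓞 F)) : ℚ_[ℓ] :=
  logInertiaDeg v * rationalDegree ℓ (residueChar v)

/-! ## Ideles -/

/-- The `ℓ`-adic compactification `R_v = lim F_vˣ / (F_vˣ) ^ (ℓ ^ n)`, written additively. -/
abbrev LocalHat (v : HeightOneSpectrum (𝓞 F)) : Type _ := Hat ℓ (Additive (v.adicCompletion F)ˣ)

/-- The normalized valuation `v : F_vˣ → ℤ ⊆ ℤ_ℓ`. -/
def ordHom (v : HeightOneSpectrum (𝓞 F)) : Additive (v.adicCompletion F)ˣ →+ ℤ_[ℓ] where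
  toFun x := ((-WithZero.log (Valued.v (x.toMul : v.adicCompletion F)) : ℤ) : ℤ_[ℓ])
  map_zero' := by simp
  map_add' x y := by
    have hx : Valued.v (x.toMul : v.adicCompletion F) ≠ 0 := by simp
    have hy : Valued.v (y.toMul : v.adicCompletion F) ≠ 0 := by simp
    rw [toMul_add, Units.val_mul, map_mul, WithZero.log_mul hx hy]
    push_cast; ring

/-- The extension `R_v → ℤ_ℓ` of the normalized valuation; its kernel is the unit subgroup of `R_v`. -/
def ordHat (v : HeightOneSpectrum (𝓞 F)) : LocalHat ℓ v →ₗ[ℤ_[ℓ]] ℤ_[ℓ] :=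
  Hat.extend ℓ (ordHom ℓ v)

/-- The norm `F_vˣ → ℚ_ℓˣ` for a place `v ∣ ℓ`. -/
def localNorm (v : HeightOneSpectrum (𝓞 F)) (hv : (ℓ : 𝓞 F) ∈ v.asIdeal) :
    (v.adicCompletion F)ˣ →* ℚ_[ℓ]ˣ :=
  letI := (padicToCompletion ℓ v hv).toAlgebra
  Units.map (Algebra.norm ℚ_[ℓ] : v.adicCompletion F →* ℚ_[ℓ])

open Classical in
/-- `x ↦ -Log_ℓ |x|_v` on `R_v`, where `|x|_v` is the `ℓ`-adic absolute value, whose logarithm is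
`Log_ℓ (N_{F_v/ℚ_ℓ} x)` if `v ∣ ℓ`, and `Log_ℓ ((N v) ^ (-v(x))) = -v(x) Log_ℓ (N v)` if `v ∤ ℓ`. -/
def negLogAbs (v : HeightOneSpectrum (𝓞 F)) : LocalHat ℓ v →ₗ[ℤ_[ℓ]] ℚ_[ℓ] :=
  if hv : (ℓ : 𝓞 F) ∈ v.asIdeal then
    Algebra.linearMap ℤ_[ℓ] ℚ_[ℓ] ∘ₗ
      Hat.extend ℓ (-((iwasawaLogHom ℓ).comp (MonoidHom.toAdditive (localNorm ℓ v hv))))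
  else
    iwasawaLog ℓ (Ideal.absNorm v.asIdeal : ℚ_[ℓ]) • (Algebra.linearMap ℤ_[ℓ] ℚ_[ℓ] ∘ₗ ordHat ℓ v)

/-- The logarithmic valuation `v~ x = -Log_ℓ |x|_v / deg_F v` on `R_v`. Explicitly, it is
`-Log_ℓ (N_{F_v/ℚ_ℓ} x) / deg_F v` for `v ∣ ℓ`, and `(f_v / f~_v) v(x)` for `v ∤ ℓ`. -/
def logVal (v : HeightOneSpectrum (𝓞 F)) : LocalHat ℓ v →ₗ[ℤ_[ℓ]] ℚ_[ℓ] :=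
  (placeDegree ℓ v)⁻¹ • negLogAbs ℓ v

variable (F)

/-- The `ℓ`-adified idele group `J_F`, written additively: the restricted product of the `R_v` over all
places of `F`, with respect to the unit subgroups at the finite places. -/
abbrev Ideles : Type _ :=
  (Πʳ v : HeightOneSpectrum (𝓞 F), [LocalHat ℓ v, (ordHat ℓ v).ker]) ×
    (∀ w : InfinitePlace F, Hat ℓ (Additive w.Completionˣ))

/-- The group of idelic logarithmic units: the kernel of all logarithmic valuations (no condition at
the infinite places). -/
def logUnits : Submodule ℤ_[ℓ] (Ideles F ℓ) where
  carrier := {x | ∀ v, logVal ℓ v (x.1 v) = 0}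
  zero_mem' v := map_zero _
  add_mem' {x y} hx hy v := by
    change logVal ℓ v (x.1 v + y.1 v) = 0
    rw [map_add, hx v, hy v, add_zero]
  smul_mem' c x hx v := by
    change logVal ℓ v (c • x.1 v) = 0
    rw [map_smul, hx v, smul_zero]

/-- The group of logarithmic divisors, the quotient of `J_F` by the idelic logarithmic units. -/
abbrev LogDivisors : Type _ := Ideles F ℓ ⧸ logUnits F ℓ

variable {F}

/-- The logarithmic valuation at `v` of an idele. -/
def ideleLogVal (v : HeightOneSpectrum (𝓞 F)) : Ideles F ℓ →ₗ[ℤ_[ℓ]] ℚ_[ℓ] where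
  toFun x := logVal ℓ v (x.1 v)
  map_add' x y := map_add (logVal ℓ v) (x.1 v) (y.1 v)
  map_smul' c x := map_smul (logVal ℓ v) c (x.1 v)

/-- The coefficient at `v` of a logarithmic divisor, i.e. the logarithmic valuation at `v` of any
idele which represents it. A logarithmic divisor is determined by its coefficients. -/
def divisorLogVal (v : HeightOneSpectrum (𝓞 F)) : LogDivisors F ℓ →ₗ[ℤ_[ℓ]] ℚ_[ℓ] :=
  (logUnits F ℓ).liftQ (ideleLogVal ℓ v) (fun _ hx => hx v)

theorem finite_places_over : {v : HeightOneSpectrum (𝓞 F) | (ℓ : 𝓞 F) ∈ v.asIdeal}.Finite := by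
  have h : Ideal.span {(ℓ : 𝓞 F)} ≠ 0 := by
    rw [Submodule.zero_eq_bot, ne_eq, Ideal.span_singleton_eq_bot]
    exact_mod_cast (Fact.out : ℓ.Prime).ne_zero
  refine (Ideal.finite_factors h).subset fun v hv => ?_
  exact Ideal.dvd_span_singleton.mpr hv

theorem logVal_eq_zero_of_unit (v : HeightOneSpectrum (𝓞 F)) (hv : (ℓ : 𝓞 F) ∉ v.asIdeal)
    (x : LocalHat ℓ v) (hx : ordHat ℓ v x = 0) : logVal ℓ v x = 0 := by
  simp [logVal, negLogAbs, hv, hx]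

theorem finite_support_divisorLogVal (d : LogDivisors F ℓ) :
    {v : HeightOneSpectrum (𝓞 F) | divisorLogVal ℓ v d ≠ 0}.Finite := by
  obtain ⟨x, rfl⟩ := Submodule.mkQ_surjective _ d
  have h : {v | ¬ x.1 v ∈ (ordHat ℓ v).ker}.Finite := x.1.2
  refine ((finite_places_over ℓ).union h).subset fun v hv => ?_
  by_contra hc
  simp only [Set.mem_union, Set.mem_ofPred_eq, not_or, not_not] at hc
  exact hv (logVal_eq_zero_of_unit ℓ v hc.1 _ hc.2)

variable (F)

/-- The degree `∑ n_v deg_F v` of a logarithmic divisor with coefficients `n_v`; the sum is finite by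
`finite_support_divisorLogVal`. -/
def degree : LogDivisors F ℓ →ₗ[ℤ_[ℓ]] ℚ_[ℓ] where
  toFun d := ∑ᶠ v : HeightOneSpectrum (𝓞 F), divisorLogVal ℓ v d * placeDegree ℓ v
  map_add' d e := by
    rw [← finsum_add_distrib]
    · simp only [map_add, add_mul]
    · exact (finite_support_divisorLogVal ℓ d).subset fun v hv => left_ne_zero_of_mul hv
    · exact (finite_support_divisorLogVal ℓ e).subset fun v hv => left_ne_zero_of_mul hv
  map_smul' c d := by
    simp only [map_smul, smul_mul_assoc, RingHom.id_apply]
    exact (smul_finsum c _).symm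

/-- The group of principal ideles `R_F = ℤ_ℓ ⊗ Fˣ`. -/
abbrev PrincipalIdeles : Type _ := ℤ_[ℓ] ⊗[ℤ] Additive Fˣ

variable {F}

/-- The canonical `ℤ_ℓ`-linear map from `ℤ_ℓ ⊗ Fˣ` to `lim Lˣ / (Lˣ) ^ (ℓ ^ n)`, for a field `L` over `F`. -/
def localize {L : Type*} [Field L] [Algebra F L] :
    PrincipalIdeles F ℓ →ₗ[ℤ_[ℓ]] Hat ℓ (Additive Lˣ) :=
  LinearMap.liftBaseChange ℤ_[ℓ] ((Hat.of ℓ (Additive Lˣ)).comp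
    (MonoidHom.toAdditive (Units.map (algebraMap F L : F →* L)))).toIntLinearMap

/-- The valuation `v : R_F → ℤ_ℓ` of a principal idele. -/
def principalVal (v : HeightOneSpectrum (𝓞 F)) : PrincipalIdeles F ℓ →ₗ[ℤ_[ℓ]] ℤ_[ℓ] :=
  ordHat ℓ v ∘ₗ localize ℓ

/-- The logarithmic valuation at `v` of a principal idele. -/
def principalLogVal (v : HeightOneSpectrum (𝓞 F)) : PrincipalIdeles F ℓ →ₗ[ℤ_[ℓ]] ℚ_[ℓ] :=
  logVal ℓ v ∘ₗ localize ℓ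

theorem ordHat_localize_tmul (v : HeightOneSpectrum (𝓞 F)) (c : ℤ_[ℓ]) (a : Additive Fˣ) :
    ordHat ℓ v (localize ℓ (c ⊗ₜ a)) =
      c * ((-WithZero.log (v.valuation F (a.toMul : F)) : ℤ) : ℤ_[ℓ]) := by
  rw [localize, LinearMap.liftBaseChange_tmul, map_smul, smul_eq_mul]
  congr 1
  refine (Hat.extend_of ℓ (ordHom ℓ v) _).trans ?_
  change ((-WithZero.log (Valued.v (algebraMap F (v.adicCompletion F) (a.toMul : F))) : ℤ) : ℤ_[ℓ]) = _
  have h : Valued.v (algebraMap F (v.adicCompletion F) (a.toMul : F))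
      = v.valuation F (a.toMul : F) := HeightOneSpectrum.valuedAdicCompletion_eq_valuation' v _
  rw [h]

theorem eventually_unit (a : PrincipalIdeles F ℓ) :
    ∀ᶠ v : HeightOneSpectrum (𝓞 F) in cofinite,
      localize ℓ a ∈ (ordHat ℓ v).ker := by
  induction a using TensorProduct.induction_on with
  | zero => exact Eventually.of_forall fun v => by rw [map_zero]; exact zero_mem _
  | add a b ha hb =>
    filter_upwards [ha, hb] with v h1 h2
    rw [map_add]; exact add_mem h1 h2
  | tmul c a =>
    have h1 := HeightOneSpectrum.Support.finite (𝓞 F) (a.toMul : F)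
    have h2 := HeightOneSpectrum.Support.finite (𝓞 F) ((a.toMul : F)⁻¹)
    filter_upwards [h1.compl_mem_cofinite, h2.compl_mem_cofinite] with v h3 h4
    simp only [HeightOneSpectrum.Support, Set.mem_compl_iff, Set.mem_ofPred_eq, not_lt,
      map_inv₀] at h3 h4
    have h5 : v.valuation F (a.toMul : F) ≠ 0 := by simp
    have h6 : v.valuation F (a.toMul : F) = 1 :=
      le_antisymm h3 ((inv_le_one₀ (zero_lt_iff.mpr h5)).mp h4)
    rw [LinearMap.mem_ker, ordHat_localize_tmul, h6]
    simp

variable (F) in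
/-- The diagonal map `R_F → J_F`. -/
def principalIdele : PrincipalIdeles F ℓ →ₗ[ℤ_[ℓ]] Ideles F ℓ where
  toFun a := (⟨fun v => localize ℓ a, eventually_unit ℓ a⟩, fun w => localize ℓ a)
  map_add' a b := by
    refine Prod.ext (RestrictedProduct.ext _ _ fun v => ?_) (funext fun w => ?_)
    · exact map_add (localize ℓ) a b
    · exact map_add (localize ℓ) a b
  map_smul' c a := by
    refine Prod.ext (RestrictedProduct.ext _ _ fun v => ?_) (funext fun w => ?_)
    · exact map_smul (localize ℓ) c a
    · exact map_smul (localize ℓ) c a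

variable (F)

/-- The map `div_F` from principal ideles to logarithmic divisors. -/
def principalDivisor : PrincipalIdeles F ℓ →ₗ[ℤ_[ℓ]] LogDivisors F ℓ :=
  (logUnits F ℓ).mkQ ∘ₗ principalIdele F ℓ

/-- The logarithmic divisors of degree zero. -/
abbrev LogDivisorsZero : Submodule ℤ_[ℓ] (LogDivisors F ℓ) := (degree F ℓ).ker

/-- The principal logarithmic divisors. -/
abbrev PrincipalLogDivisors : Submodule ℤ_[ℓ] (LogDivisors F ℓ) := (principalDivisor F ℓ).range

/-- The logarithmic `ℓ`-class group of `F`: logarithmic divisors of degree zero modulo principal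
ones. -/
abbrev LogClassGroup : Type _ :=
  ↥(LogDivisorsZero F ℓ) ⧸ (PrincipalLogDivisors F ℓ).submoduleOf (LogDivisorsZero F ℓ)

/-- The group of `ℓ`-ideals `∏ v ^ (α_v)`, the product over the primes `v ∤ ℓ`, with exponents
`α_v ∈ ℤ_ℓ`; written additively. -/
def EllIdeals : Type _ :=
  {v : HeightOneSpectrum (𝓞 F) // (ℓ : 𝓞 F) ∉ v.asIdeal} →₀ ℤ_[ℓ]

instance : AddCommGroup (EllIdeals F ℓ) :=
  inferInstanceAs (AddCommGroup ({v : HeightOneSpectrum (𝓞 F) // (ℓ : 𝓞 F) ∉ v.asIdeal} →₀ ℤ_[ℓ]))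

instance : Module ℤ_[ℓ] (EllIdeals F ℓ) :=
  inferInstanceAs
    (Module ℤ_[ℓ] ({v : HeightOneSpectrum (𝓞 F) // (ℓ : 𝓞 F) ∉ v.asIdeal} →₀ ℤ_[ℓ]))

/-- The exponent `α_v` of an `ℓ`-ideal at `v`. -/
def exponent (v : {v : HeightOneSpectrum (𝓞 F) // (ℓ : 𝓞 F) ∉ v.asIdeal}) :
    EllIdeals F ℓ →ₗ[ℤ_[ℓ]] ℤ_[ℓ] :=
  Finsupp.lapply v

variable {F}

/-- The quotient `λ_v = f_v / f~_v` of the classical and the logarithmic inertia degree. -/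
def lambdaFactor (v : HeightOneSpectrum (𝓞 F)) : ℚ_[ℓ] :=
  (v.asIdeal.inertiaDeg ℤ : ℚ_[ℓ]) / (logInertiaDeg v : ℚ_[ℓ])

variable (F)

/-- The degree of the logarithmic divisor `∑ λ_v α_v v` which is attached to an `ℓ`-ideal
`∏ v ^ (α_v)`. -/
def ellIdealDegree : EllIdeals F ℓ →ₗ[ℤ_[ℓ]] ℚ_[ℓ] :=
  Finsupp.lsum (M := ℤ_[ℓ]) ℤ_[ℓ] fun v : {v : HeightOneSpectrum (𝓞 F) // (ℓ : 𝓞 F) ∉ v.asIdeal} =>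
    (lambdaFactor ℓ v.1 * placeDegree ℓ v.1) • Algebra.linearMap ℤ_[ℓ] ℚ_[ℓ]

/-- The `ℓ`-ideals of logarithmic degree zero. -/
abbrev EllIdealsZero : Submodule ℤ_[ℓ] (EllIdeals F ℓ) := (ellIdealDegree F ℓ).ker

/-- The `ℓ`-ideals `∏ v ^ (v(a))`, over `v ∤ ℓ`, of the principal ideles `a` whose logarithmic
valuations vanish at all places above `ℓ`. -/
def PrincipalEllIdeals : Submodule ℤ_[ℓ] (EllIdeals F ℓ) where
  carrier := {α | ∃ a : PrincipalIdeles F ℓ,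
    (∀ v : HeightOneSpectrum (𝓞 F), (ℓ : 𝓞 F) ∈ v.asIdeal → principalLogVal ℓ v a = 0) ∧
    ∀ v, exponent F ℓ v α = principalVal ℓ v.1 a}
  zero_mem' := ⟨0, fun v _ => map_zero _, fun v => by rw [map_zero, map_zero]⟩
  add_mem' := by
    rintro α β ⟨a, ha, ha'⟩ ⟨b, hb, hb'⟩
    refine ⟨a + b, fun v hv => ?_, fun v => ?_⟩
    · rw [map_add, ha v hv, hb v hv, add_zero]
    · rw [map_add, map_add, ha', hb']
  smul_mem' := by
    rintro c α ⟨a, ha, ha'⟩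
    refine ⟨c • a, fun v hv => ?_, fun v => ?_⟩
    · rw [map_smul, ha v hv, smul_zero]
    · rw [map_smul, map_smul, ha']

/-- The `ℓ`-ideals of logarithmic degree zero modulo the subgroup `PrincipalEllIdeals`. -/
abbrev EllIdealClassGroup : Type _ :=
  ↥(EllIdealsZero F ℓ) ⧸ (PrincipalEllIdeals F ℓ).submoduleOf (EllIdealsZero F ℓ)

end Global

end LogClass

end

/-! An `ℓ`-ideal is sent to the logarithmic divisor with coefficients `λ_v α_v` off `ℓ` and `0`
above `ℓ` (`ellIdealDivisor`). This map preserves degrees. The theorem says that it induces an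
isomorphism on classes, and three facts are needed.

Kernel. Off `ℓ` the logarithmic valuation is `λ_v` times the ordinary one, with `λ_v ≠ 0`. So the
divisor of an `ℓ`-ideal is `div_F(a)` exactly when `a` has trivial logarithmic valuations above `ℓ`
and the ordinary valuations of `a` off `ℓ` are the exponents of the ideal
(`principalDivisor_eq_ellIdealDivisor_iff`).

Surjectivity. Every logarithmic divisor can be cleared above `ℓ` by a principal one
(`exists_principalLogVal_eq`). By weak approximation `F` is dense in the product of the `F_v`, `v ∣
ℓ`, and `Log_ℓ` of the local norm is continuous. The image of `R_F` in the corresponding finite free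
`ℤ_ℓ`-module is therefore dense modulo every `ℓ ^ n` in the values taken by ideles. Being a
submodule of a finitely generated `ℤ_ℓ`-module, it contains those values by Krull's intersection
theorem.

Principal divisors have degree zero (`degree_principalDivisor`). Multiplied by `deg v`, the
logarithmic valuation becomes `-Log_ℓ |x|_v`, so this is a product formula. The places above `ℓ`
contribute `Log_ℓ` of the product of the local norms, which is the global norm because an integral
basis of `F` is a `ℚ_ℓ`-basis of the product of the `F_v`. The other places contribute the inverse
of its absolute value, since `Log_ℓ ℓ = 0` and `Log_ℓ (-1) = 0`.

Dividing by degrees is legitimate because `Log_ℓ p ≠ 0` for `p ≠ ℓ` and the logarithmic inertia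
degrees are finite and positive. -/

noncomputable section

namespace LogClass

open Filter Topology
open scoped WithZero TensorProduct RestrictedProduct

/-! ### Nonvanishing, functional equation and continuity of the Iwasawa logarithm. -/

section LogarithmProperties

variable (ℓ : ℕ) [Fact ℓ.Prime]

/-- Lifting the exponent. For `ℓ = 2` the formula needs an even exponent, hence the separate case `n
= 0` and the larger constant. -/
theorem exists_padicValNat_pow_sub_one_le (u : ℕ) (hu : 1 < u) (h : ℓ ∣ u - 1) :
    ∃ C : ℕ, ∀ n : ℕ, padicValNat ℓ (u ^ ℓ ^ n - 1) ≤ n + C := by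
  have hℓ : ℓ.Prime := Fact.out
  have hndvd : ¬ ℓ ∣ u := fun h' => hℓ.one_lt.ne' <| Nat.dvd_one.mp <| by
    have := Nat.dvd_sub h' h
    rwa [Nat.sub_sub_self hu.le] at this
  rcases hℓ.eq_two_or_odd' with rfl | hodd
  · refine ⟨padicValNat 2 (u + 1) + padicValNat 2 (u - 1), fun n => ?_⟩
    rcases n with _ | n
    · simp
    · have h1 := padicValNat.pow_two_sub_one (n := 2 ^ (n + 1)) hu hndvd (by positivity)
        (by rw [pow_succ]; exact even_two.mul_left _)
      rw [padicValNat.prime_pow] at h1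
      omega
  · refine ⟨padicValNat ℓ (u - 1), fun n => ?_⟩
    have h1 := padicValNat.pow_sub_pow (x := u) (y := 1) hodd hu h hndvd
      (n := ℓ ^ n) (pow_ne_zero _ hℓ.ne_zero)
    rw [padicValNat.prime_pow, one_pow] at h1
    omega

/-- The logarithm is the limit of `(u ^ ℓ ^ n - 1) / ℓ ^ n`, and the preceding bound keeps the norms
of these quotients above `ℓ ^ (-C)`. -/
theorem padicLog_natCast_sub_one_ne_zero (u : ℕ) (hu : 1 < u) (h : ℓ ∣ u - 1) :
    padicLog ℓ ((u : ℚ_[ℓ]) - 1) ≠ 0 := by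
  have hℓ : ℓ.Prime := Fact.out
  obtain ⟨C, hC⟩ := exists_padicValNat_pow_sub_one_le ℓ u hu h
  have hz : ‖(u : ℚ_[ℓ]) - 1‖ < 1 := by
    have : (u : ℚ_[ℓ]) - 1 = ((u - 1 : ℕ) : ℚ_[ℓ]) := by push_cast [Nat.cast_sub hu.le]; rfl
    rw [this, Padic.norm_natCast_lt_one_iff]
    exact h
  have key : (ℓ : ℝ) ^ (-(C : ℤ)) ≤ ‖padicLog ℓ ((u : ℚ_[ℓ]) - 1)‖ := by
    refine ge_of_tendsto (tendsto_padicLog ℓ _ hz).norm (Eventually.of_forall fun n => ?_)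
    have hpos : 1 < u ^ ℓ ^ n := Nat.one_lt_pow (pow_ne_zero _ hℓ.ne_zero) hu
    have h1 : (1 + ((u : ℚ_[ℓ]) - 1)) ^ ℓ ^ n - 1 = ((u ^ ℓ ^ n - 1 : ℕ) : ℚ_[ℓ]) := by
      rw [Nat.cast_sub hpos.le]; push_cast; ring
    have h2 : ((u ^ ℓ ^ n - 1 : ℕ) : ℚ_[ℓ]) ≠ 0 := by
      exact_mod_cast (Nat.sub_pos_of_lt hpos).ne'
    have hℓ0 : (ℓ : ℝ) ≠ 0 := by exact_mod_cast hℓ.ne_zero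
    rw [h1, norm_div, norm_pow, Padic.norm_p, Padic.norm_eq_zpow_neg_valuation h2,
      Padic.valuation_natCast, inv_pow, div_inv_eq_mul, ← zpow_natCast, ← zpow_add₀ hℓ0]
    refine zpow_le_zpow_right₀ (by exact_mod_cast hℓ.one_lt.le) ?_
    have := hC n
    omega
  intro h0
  rw [h0, norm_zero] at key
  exact absurd key (not_le.mpr (zpow_pos (by exact_mod_cast hℓ.pos) _))

theorem unitPart_eq_self {x : ℚ_[ℓ]} (hx : ‖x‖ = 1) : unitPart ℓ x = x := by
  have hx0 : x ≠ 0 := norm_ne_zero_iff.mp (by rw [hx]; exact one_ne_zero)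
  have hv : x.valuation = 0 := by
    rw [Padic.norm_eq_zpow_neg_valuation hx0] at hx
    have hℓ : (1 : ℝ) < ℓ := by exact_mod_cast (Fact.out : ℓ.Prime).one_lt
    have := (zpow_eq_one_iff_right₀ (by positivity) hℓ.ne').mp hx
    omega
  rw [unitPart, hv, neg_zero, zpow_zero, mul_one]

theorem iwasawaLog_prime_ne_zero (p : ℕ) (hp : p.Prime) (hpℓ : p ≠ ℓ) :
    iwasawaLog ℓ (p : ℚ_[ℓ]) ≠ 0 := by
  have hℓ : ℓ.Prime := Fact.out
  have hn : ‖(p : ℚ_[ℓ])‖ = 1 := by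
    rw [Padic.norm_natCast_eq_one_iff]
    exact (Nat.coprime_primes hℓ hp).mpr hpℓ.symm
  have hℓ1 : ℓ - 1 ≠ 0 := by have := hℓ.two_le; omega
  have hu : 1 < p ^ (ℓ - 1) := Nat.one_lt_pow hℓ1 hp.one_lt
  rw [iwasawaLog]
  refine div_ne_zero ?_ (by exact_mod_cast hℓ1)
  have h1 := norm_unitPart_pow ℓ (p : ℚ_[ℓ]) (by exact_mod_cast hp.ne_zero)
  rw [unitPart_eq_self ℓ hn] at h1 ⊢
  have h2 : (p : ℚ_[ℓ]) ^ (ℓ - 1) - 1 = ((p ^ (ℓ - 1) : ℕ) : ℚ_[ℓ]) - 1 := by push_cast; rfl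
  have h3 : (p : ℚ_[ℓ]) ^ (ℓ - 1) - 1 = ((p ^ (ℓ - 1) - 1 : ℕ) : ℚ_[ℓ]) := by
    rw [Nat.cast_sub hu.le]; push_cast; rfl
  rw [h3, Padic.norm_natCast_lt_one_iff] at h1
  rw [h2]
  exact padicLog_natCast_sub_one_ne_zero ℓ _ hu h1

theorem rationalDegree_ne_zero (p : ℕ) (hp : p.Prime) : rationalDegree ℓ p ≠ 0 := by
  rw [rationalDegree]
  split_ifs with h1 h2
  · norm_num
  · exact_mod_cast (Fact.out : ℓ.Prime).ne_zero
  · exact iwasawaLog_prime_ne_zero ℓ p hp h1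

/-- Termwise and ultrametric: `‖z‖ ≤ 1 / ℓ`, while `‖1 / (n + 1)‖ ≤ n + 1 ≤ ℓ ^ n`, so the factor
multiplying `z` in each term has norm at most `1`. This bound gives continuity of `iwasawaLog` at
`1`. -/
theorem norm_padicLog_le_norm (z : ℚ_[ℓ]) (hz : ‖z‖ < 1) : ‖padicLog ℓ z‖ ≤ ‖z‖ := by
  have hℓ : ℓ.Prime := Fact.out
  have hℓ0 : (0 : ℝ) < ℓ := by exact_mod_cast hℓ.pos
  have hz' : ‖z‖ ≤ (ℓ : ℝ)⁻¹ := by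
    have := (Padic.norm_le_pow_iff_norm_lt_pow_add_one z (-1)).mpr (by simpa using hz)
    simpa using this
  rw [padicLog]
  refine IsUltrametricDist.norm_tsum_le_of_forall_le_of_nonneg (norm_nonneg _) fun n => ?_
  have h2 := norm_inv_natCast_le ℓ (n + 1) (Nat.succ_ne_zero n)
  have h3 : ((n + 1 : ℕ) : ℝ) ≤ (ℓ : ℝ) ^ n := by
    have : n + 1 ≤ ℓ ^ n := Nat.lt_pow_self hℓ.one_lt
    exact_mod_cast this
  push_cast at h2 h3
  rw [div_eq_mul_inv, norm_mul, norm_mul, norm_pow, norm_pow, norm_neg, norm_one, one_pow, one_mul,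
    pow_succ', mul_assoc]
  refine mul_le_of_le_one_right (norm_nonneg _) ?_
  calc ‖z‖ ^ n * ‖((n : ℚ_[ℓ]) + 1)⁻¹‖ ≤ ((ℓ : ℝ)⁻¹) ^ n * (ℓ : ℝ) ^ n := by
        gcongr
        exact h2.trans h3
    _ = 1 := by rw [inv_pow, inv_mul_cancel₀ (by positivity)]

theorem norm_iwasawaLog_one_add_le (z : ℚ_[ℓ]) (hz : ‖z‖ < 1) : ‖iwasawaLog ℓ (1 + z)‖ ≤ ‖z‖ := by
  have hℓ : ℓ.Prime := Fact.out
  have h1 : ‖1 + z‖ = 1 := by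
    rw [IsUltrametricDist.norm_add_eq_max_of_norm_ne_norm] <;> simp [hz.le, hz.ne']
  have h : ‖((ℓ - 1 : ℕ) : ℚ_[ℓ])‖ = 1 := by
    rw [Padic.norm_natCast_eq_one_iff]
    exact (Nat.coprime_self_sub_right hℓ.one_lt.le).mpr (Nat.coprime_one_right _)
  have h2 : ‖(1 + z) ^ (ℓ - 1) - 1‖ ≤ ‖z‖ := by
    set y : ℤ_[ℓ] := ⟨1 + z, h1.le⟩
    obtain ⟨c, hc⟩ := sub_dvd_pow_sub_pow y 1 (ℓ - 1)
    have hc' : (1 + z) ^ (ℓ - 1) - 1 = z * c := by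
      have := congrArg (fun t : ℤ_[ℓ] => (t : ℚ_[ℓ])) hc
      push_cast at this
      rwa [one_pow, add_sub_cancel_left] at this
    rw [hc', norm_mul]
    exact mul_le_of_le_one_right (norm_nonneg _) c.2
  rw [iwasawaLog, norm_div, h, div_one, unitPart_eq_self ℓ h1]
  exact (norm_padicLog_le_norm ℓ _ (h2.trans_lt hz)).trans h2

theorem iwasawaLog_one : iwasawaLog ℓ 1 = 0 := by
  have := iwasawaLog_mul ℓ 1 1 one_ne_zero one_ne_zero
  simpa using this

theorem iwasawaLog_inv (x : ℚ_[ℓ]) (hx : x ≠ 0) : iwasawaLog ℓ x⁻¹ = -iwasawaLog ℓ x := by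
  have := iwasawaLog_mul ℓ x x⁻¹ hx (inv_ne_zero hx)
  rw [mul_inv_cancel₀ hx, iwasawaLog_one] at this
  linear_combination -this

/-- `2 Log_ℓ (-1) = Log_ℓ 1 = 0`, and `ℚ_ℓ` has characteristic zero. -/
theorem iwasawaLog_neg (x : ℚ_[ℓ]) (hx : x ≠ 0) : iwasawaLog ℓ (-x) = iwasawaLog ℓ x := by
  have h1 := iwasawaLog_mul ℓ (-1) (-1) (by norm_num) (by norm_num)
  have h2 := iwasawaLog_mul ℓ (-1) x (by norm_num) hx
  norm_num [iwasawaLog_one] at h1 h2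
  linear_combination h2 - h1 / 2

theorem iwasawaLog_self : iwasawaLog ℓ (ℓ : ℚ_[ℓ]) = 0 := by
  have hℓ : (ℓ : ℚ_[ℓ]) ≠ 0 := by exact_mod_cast (Fact.out : ℓ.Prime).ne_zero
  rw [iwasawaLog, unitPart, Padic.valuation_p, zpow_neg, zpow_one, mul_inv_cancel₀ hℓ]
  simp [padicLog]

theorem iwasawaLog_pow (x : ℚ_[ℓ]) (hx : x ≠ 0) (n : ℕ) :
    iwasawaLog ℓ (x ^ n) = n * iwasawaLog ℓ x := by
  induction n with
  | zero => simp [iwasawaLog_one]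
  | succ n ih => rw [pow_succ, iwasawaLog_mul ℓ _ _ (pow_ne_zero _ hx) hx, ih]; push_cast; ring

theorem iwasawaLog_zpow (x : ℚ_[ℓ]) (hx : x ≠ 0) (n : ℤ) :
    iwasawaLog ℓ (x ^ n) = n * iwasawaLog ℓ x := by
  obtain ⟨m, rfl | rfl⟩ := n.eq_nat_or_neg
  · simpa using iwasawaLog_pow ℓ x hx m
  · rw [zpow_neg, zpow_natCast, iwasawaLog_inv ℓ _ (pow_ne_zero _ hx), iwasawaLog_pow ℓ x hx]
    push_cast; ring

/-- A homomorphism continuous at `1` is continuous everywhere: translate by `x⁻¹`. -/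
theorem continuousAt_iwasawaLog (x : ℚ_[ℓ]) (hx : x ≠ 0) : ContinuousAt (iwasawaLog ℓ) x := by
  have h1 : ContinuousAt (iwasawaLog ℓ) 1 := by
    rw [ContinuousAt, iwasawaLog_one, Metric.tendsto_nhds_nhds]
    refine fun ε hε => ⟨min 1 ε, by positivity, fun {y} hy => ?_⟩
    rw [dist_eq_norm, lt_min_iff] at hy
    have := norm_iwasawaLog_one_add_le ℓ (y - 1) hy.1
    rw [add_sub_cancel] at this
    rw [dist_zero_right]
    exact this.trans_lt hy.2
  have h2 : ContinuousAt (fun y => iwasawaLog ℓ (x⁻¹ * y)) x := by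
    refine ContinuousAt.comp (g := iwasawaLog ℓ) ?_ (by fun_prop)
    rwa [inv_mul_cancel₀ hx]
  refine (h2.const_add (iwasawaLog ℓ x)).congr ?_
  filter_upwards [isOpen_ne.mem_nhds hx] with y hy
  rw [← iwasawaLog_mul ℓ _ _ hx (mul_ne_zero (inv_ne_zero hx) hy), mul_inv_cancel_left₀ hx]

end LogarithmProperties

/-- In a basis adapted to the factors, multiplication by `x` has a block diagonal matrix whose
blocks are the multiplications by the `x i`. -/
theorem norm_pi_eq_prod {K ι : Type*} [Field K] [Fintype ι] {A : ι → Type*}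
    [∀ i, CommRing (A i)] [∀ i, Algebra K (A i)] [∀ i, Module.Finite K (A i)] (x : ∀ i, A i) :
    Algebra.norm K x = ∏ i, Algebra.norm K (x i) := by
  classical
  let b := fun i => Module.Free.chooseBasis K (A i)
  let e := Fintype.equivFin ι
  let M := Algebra.leftMulMatrix (Pi.basis b) x
  have hM : ∀ r s, M r s = (b r.1).repr ((x * Pi.single s.1 (b s.1 s.2) : ∀ i, A i) r.1) r.2 := by
    intro r s
    simp only [M]
    rw [Algebra.leftMulMatrix_eq_repr_mul, Pi.basis_apply, Pi.basis_repr]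
  -- Triangularity needs ordered block labels, so the index set is numbered by `e`.
  have hT : M.BlockTriangular fun a => e a.1 := by
    intro r s hrs
    have hne : r.1 ≠ s.1 := fun h => hrs.ne (by simp only [h])
    rw [hM, Pi.mul_apply, Pi.single_eq_of_ne hne, mul_zero, map_zero, Finsupp.zero_apply]
  rw [Algebra.norm_eq_matrix_det (Pi.basis b) x, hT.det_fintype, ← e.prod_comp]
  refine Finset.prod_congr rfl fun i _ => ?_
  let f : Module.Free.ChooseBasisIndex K (A i) ≃
      {a : (i : ι) × Module.Free.ChooseBasisIndex K (A i) // e a.1 = e i} :=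
    { toFun := fun j => ⟨⟨i, j⟩, rfl⟩
      invFun := fun a => (e.injective a.2) ▸ a.1.2
      left_inv := fun j => rfl
      right_inv := by
        rintro ⟨⟨i', j⟩, h⟩
        obtain rfl := e.injective h
        rfl }
  rw [Algebra.norm_eq_matrix_det (b i), ← Matrix.det_submatrix_equiv_self f]
  congr 1
  ext j k
  rw [Algebra.leftMulMatrix_eq_repr_mul]
  change M ⟨i, j⟩ ⟨i, k⟩ = _
  rw [hM, Pi.mul_apply, Pi.single_eq_same]

/-! ### Weak approximation at finitely many finite places. -/

section Approximation

variable {F : Type*} [Field F] [NumberField F]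

theorem exists_exp_le_subset_of_mem_nhds (v : HeightOneSpectrum (𝓞 F)) {x : v.adicCompletion F}
    {U : Set (v.adicCompletion F)} (hU : U ∈ 𝓝 x) :
    ∃ N : ℕ, ∀ y, Valued.v (y - x) ≤ WithZero.exp (-(N : ℤ)) → y ∈ U := by
  obtain ⟨γ, hγ⟩ := Valued.mem_nhds.mp hU
  have hγ0 : MonoidWithZeroHom.ValueGroup₀.embedding γ.1 ≠ 0 :=
    MonoidWithZeroHom.ValueGroup₀.embedding_unit_ne_zero γ
  refine ⟨(WithZero.log (MonoidWithZeroHom.ValueGroup₀.embedding γ.1)).natAbs + 1,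
    fun y hy => hγ ?_⟩
  simp only [Set.mem_ofPred_eq, Valuation.restrict_lt_iff_lt_embedding]
  refine lt_of_le_of_lt hy ?_
  rw [← WithZero.lt_log_iff_exp_lt hγ0]
  have := neg_abs_le (WithZero.log (MonoidWithZeroHom.ValueGroup₀.embedding γ.1))
  push_cast
  linarith

/-- Clear denominators, then apply the Chinese remainder theorem in the ring of integers. -/
theorem exists_forall_valuation_sub_le (S : Finset (HeightOneSpectrum (𝓞 F)))
    (y : HeightOneSpectrum (𝓞 F) → F) (N : ℕ) :
    ∃ a : F, ∀ v ∈ S, v.valuation F (a - y v) ≤ WithZero.exp (-(N : ℤ)) := by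
  classical
  obtain ⟨d, hd⟩ := IsLocalization.exist_integer_multiples (nonZeroDivisors (𝓞 F)) S y
  have hd0 : (algebraMap (𝓞 F) F (d : 𝓞 F)) ≠ 0 :=
    IsFractionRing.to_map_ne_zero_of_mem_nonZeroDivisors d.2
  choose! z hz using hd
  -- The extra precision `m v` makes up for the later division by the common denominator `d`.
  let m : HeightOneSpectrum (𝓞 F) → ℕ := fun v => (WithZero.log (v.valuation F (algebraMap (𝓞 F) F (d : 𝓞 F)))).natAbs
  obtain ⟨b, hb⟩ := IsDedekindDomain.exists_forall_sub_mem_ideal (s := S)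
    (fun v : HeightOneSpectrum (𝓞 F) => v.asIdeal) (fun v => N + m v)
    (fun v _ => v.prime) (fun v _ w _ hvw h => hvw (HeightOneSpectrum.ext h)) (fun v => z v.1)
  refine ⟨algebraMap _ F b / algebraMap _ F (d : 𝓞 F), fun v hv => ?_⟩
  have h1 : algebraMap _ F b / algebraMap _ F (d : 𝓞 F) - y v
      = algebraMap (𝓞 F) F (b - z v) / algebraMap _ F (d : 𝓞 F) := by
    rw [map_sub, hz v hv, sub_div]
    congr 1
    rw [Algebra.smul_def, mul_div_cancel_left₀ _ hd0]
  have h2 : v.valuation F (algebraMap (𝓞 F) F (b - z v))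
      ≤ WithZero.exp (-((N + m v : ℕ) : ℤ)) := by
    rw [HeightOneSpectrum.valuation_of_algebraMap, HeightOneSpectrum.intValuation_le_pow_iff_mem]
    exact hb v hv
  have h3 : v.valuation F (algebraMap (𝓞 F) F (d : 𝓞 F)) ≠ 0 := by rwa [Valuation.ne_zero_iff]
  have h4 : WithZero.exp (-(m v : ℤ)) ≤ v.valuation F (algebraMap (𝓞 F) F (d : 𝓞 F)) := by
    rw [← WithZero.le_log_iff_exp_le h3]
    have := neg_abs_le (WithZero.log (v.valuation F (algebraMap (𝓞 F) F (d : 𝓞 F))))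
    simp only [m]
    omega
  rw [h1, map_div₀, div_le_iff₀ (zero_lt_iff.mpr h3)]
  refine h2.trans ?_
  calc WithZero.exp (-((N + m v : ℕ) : ℤ)) = WithZero.exp (-(N : ℤ)) * WithZero.exp (-(m v : ℤ)) := by
        rw [← WithZero.exp_add]; congr 1; push_cast; ring
    _ ≤ _ := by gcongr

/-- Weak approximation at finitely many finite places. -/
theorem denseRange_algebraMap_pi {ι : Type*} [Finite ι] (w : ι → HeightOneSpectrum (𝓞 F))
    (hw : Function.Injective w) :
    DenseRange fun (a : F) (i : ι) => algebraMap F ((w i).adicCompletion F) a := by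
  classical
  have := Fintype.ofFinite ι
  have h1 : DenseRange (Pi.map fun i => algebraMap F ((w i).adicCompletion F)) :=
    DenseRange.piMap fun i => HeightOneSpectrum.denseRange_algebraMap F (w i)
  -- Each `F → F_v` has dense image, so families of independent elements of `F` are dense in the
  -- product. It remains to approximate such a family by a single element of `F`.
  refine Dense.of_closure ?_
  refine h1.mono ?_
  rintro _ ⟨y, rfl⟩
  rw [mem_closure_iff_nhds]
  intro U hU
  rw [nhds_pi, Filter.mem_pi'] at hU
  obtain ⟨I, t, ht, hsub⟩ := hU
  choose N hN using fun i => exists_exp_le_subset_of_mem_nhds (w i) (ht i)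
  obtain ⟨a, ha⟩ := exists_forall_valuation_sub_le (Finset.univ.image w)
    -- The targets are reindexed by places; the value `0` is never used, and injectivity of `w`
    -- recovers `y i`.
    (fun v => if h : ∃ i, w i = v then y h.choose else 0) (Finset.univ.sup N)
  refine ⟨fun i => algebraMap F ((w i).adicCompletion F) a, hsub fun i _ => hN i _ ?_, a, rfl⟩
  have h2 := ha (w i) (Finset.mem_image_of_mem w (Finset.mem_univ i))
  have h3 : ∃ j, w j = w i := ⟨i, rfl⟩
  rw [dif_pos h3, hw h3.choose_spec] at h2
  have h4 : algebraMap F ((w i).adicCompletion F) a - Pi.map (fun i => algebraMap F ((w i).adicCompletion F)) y i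
      = algebraMap F ((w i).adicCompletion F) (a - y i) := by rw [map_sub]; rfl
  rw [h4]
  have h5 : Valued.v (algebraMap F ((w i).adicCompletion F) (a - y i)) = (w i).valuation F (a - y i) :=
    HeightOneSpectrum.valuedAdicCompletion_eq_valuation' _ _
  rw [h5]
  refine h2.trans ?_
  rw [WithZero.exp_le_exp]
  have := Finset.le_sup (f := N) (Finset.mem_univ i)
  omega

end Approximation

/-! ### The product of the completions above `p`, and the global norm as a product of local norms.
-/

section LocalGlobal

variable {F : Type*} [Field F] [NumberField F] (p : ℕ) [Fact p.Prime]

theorem continuous_padicToCompletion (v : HeightOneSpectrum (𝓞 F)) (hp : (p : 𝓞 F) ∈ v.asIdeal) :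
    Continuous (padicToCompletion p v hp) := by
  refine Continuous.comp (g := UniformSpace.Completion.extensionHom (ratToCompletion p v)
    (continuous_ratToCompletion p v hp)) UniformSpace.Completion.continuous_extension ?_
  exact (Padic.withValUniformEquiv (p := p)).symm.continuous

/-- The condition is closed and holds on the dense subset `ℤ` of `ℤ_p`. -/
theorem valued_padicToCompletion_le_one (v : HeightOneSpectrum (𝓞 F))
    (hp : (p : 𝓞 F) ∈ v.asIdeal) (z : ℤ_[p]) :
    Valued.v (padicToCompletion p v hp (z : ℚ_[p])) ≤ 1 := by
  have hcl : IsClosed {x : v.adicCompletion F | Valued.v x ≤ 1} := 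
    Valued.isClosed_integer (v.adicCompletion F)
  have hcont : Continuous fun z : ℤ_[p] => padicToCompletion p v hp (z : ℚ_[p]) :=
    (continuous_padicToCompletion p v hp).comp continuous_subtype_val
  refine PadicInt.denseRange_intCast.induction_on z (hcl.preimage hcont) fun n => ?_
  change Valued.v (padicToCompletion p v hp ((n : ℤ_[p]) : ℚ_[p])) ≤ 1
  rw [PadicInt.coe_intCast, map_intCast]
  have h : Valued.v (algebraMap F (v.adicCompletion F) (n : F)) = v.valuation F (n : F) :=
    HeightOneSpectrum.valuedAdicCompletion_eq_valuation' v _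
  have h1 : v.valuation F (algebraMap (𝓞 F) F (n : 𝓞 F)) ≤ 1 := v.valuation_le_one _
  have h2 : algebraMap (𝓞 F) F (n : 𝓞 F) = (n : F) := map_intCast _ _
  rw [h2] at h1
  rw [map_intCast] at h
  exact h.trans_le h1

variable (F) in
/-- The finite places of `F` above `p`. -/
abbrev PlacesOver : Type _ := {v : HeightOneSpectrum (𝓞 F) // (p : 𝓞 F) ∈ v.asIdeal}

instance : Finite (PlacesOver F p) := (finite_places_over p).to_subtype

/-- The completion of `F` at a place above `p` as an algebra over `ℚ_p`. -/
instance padicAlgebra (v : PlacesOver F p) : Algebra ℚ_[p] (v.1.adicCompletion F) :=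
  (padicToCompletion p v.1 v.2).toAlgebra

instance (v : PlacesOver F p) : ContinuousSMul ℚ_[p] (v.1.adicCompletion F) :=
  continuousSMul_of_algebraMap _ _ (continuous_padicToCompletion p v.1 v.2)

variable (F) in
/-- An integral basis of `F` inside the product of the completions at the places above `p`. -/
def completionFamily (i : Module.Free.ChooseBasisIndex ℤ (𝓞 F)) (v : PlacesOver F p) :
    v.1.adicCompletion F :=
  algebraMap F (v.1.adicCompletion F) (algebraMap (𝓞 F) F (RingOfIntegers.basis F i))

theorem algebraMap_sum_ratCast_mul_basis (q : Module.Free.ChooseBasisIndex ℤ (𝓞 F) → ℚ)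
    (v : PlacesOver F p) :
    algebraMap F (v.1.adicCompletion F)
        (∑ i, (q i : F) * algebraMap (𝓞 F) F (RingOfIntegers.basis F i))
      = ∑ i, (q i : ℚ_[p]) • completionFamily F p i v := by
  rw [map_sum]
  refine Finset.sum_congr rfl fun i _ => ?_
  rw [completionFamily, Algebra.smul_def, map_mul, map_ratCast, map_ratCast]

theorem algebraMap_sum_zsmul_basis (n : Module.Free.ChooseBasisIndex ℤ (𝓞 F) → ℤ) :
    algebraMap (𝓞 F) F (∑ i, n i • RingOfIntegers.basis F i)
      = ∑ i, ((n i : ℚ) : F) * algebraMap (𝓞 F) F (RingOfIntegers.basis F i) := by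
  rw [map_sum]
  refine Finset.sum_congr rfl fun i _ => ?_
  rw [map_zsmul, zsmul_eq_mul, Rat.cast_intCast]

/-- A relation is scaled so that its coefficients lie in `ℤ_p` and one of them is `1`. Replacing the
coefficients by integers congruent modulo `p` gives an algebraic integer `a` with `a / p` integral
at every place. Hence `a` is divisible by `p` in the ring of integers, and so are its coordinates in
the integral basis, including one congruent to `1`. -/
theorem linearIndependent_completionFamily : LinearIndependent ℚ_[p] (completionFamily F p) := by
  rw [Fintype.linearIndependent_iff]
  intro c hc
  by_contra! hne
  obtain ⟨i₁, hi₁⟩ := hne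
  obtain ⟨i₀, -, hi₀⟩ := Finset.exists_max_image Finset.univ (fun i => ‖c i‖) ⟨i₁, Finset.mem_univ _⟩
  have hc₀ : c i₀ ≠ 0 := by
    intro h
    have := hi₀ i₁ (Finset.mem_univ _)
    rw [h, norm_zero] at this
    exact hi₁ (norm_le_zero_iff.mp this)
  let z : Module.Free.ChooseBasisIndex ℤ (𝓞 F) → ℤ_[p] := fun i => ⟨c i / c i₀, by
    rw [norm_div]
    exact div_le_one_of_le₀ (hi₀ i (Finset.mem_univ _)) (norm_nonneg _)⟩
  have hz₀ : z i₀ = 1 := Subtype.ext (div_self hc₀)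
  have hz : ∀ v : PlacesOver F p, ∑ i, (z i : ℚ_[p]) • completionFamily F p i v = 0 := by
    intro v
    have h := congrFun hc v
    rw [Finset.sum_apply, Pi.zero_apply] at h
    have h' : ∑ i, (z i : ℚ_[p]) • completionFamily F p i v
        = (c i₀)⁻¹ • ∑ i, (c i • completionFamily F p i) v := by
      rw [Finset.smul_sum]
      refine Finset.sum_congr rfl fun i _ => ?_
      rw [Pi.smul_apply, smul_smul]
      congr 1
      exact div_eq_inv_mul _ _
    rw [h', h, smul_zero]
  choose n hn using fun i => exists_int p 1 (z i)
  choose d hd using hn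
  set a : 𝓞 F := ∑ i, n i • RingOfIntegers.basis F i with ha
  have hp0 : (p : F) ≠ 0 := by exact_mod_cast (Fact.out : p.Prime).ne_zero
  -- Writing `z i = n i + p * d i`, the exact relation `hz` turns `a / p` into `-∑ d i ω_i` in the
  -- completion, where `ω_i` are the basis elements.
  have hover : ∀ w : PlacesOver F p, w.1.valuation F (algebraMap (𝓞 F) F a / p) ≤ 1 := by
    intro w
    have h1 : algebraMap F (w.1.adicCompletion F) (algebraMap (𝓞 F) F a / p)
        = -∑ i, padicToCompletion p w.1 w.2 (d i : ℚ_[p]) *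
          algebraMap F (w.1.adicCompletion F) (algebraMap (𝓞 F) F (RingOfIntegers.basis F i)) := by
      have hp' : algebraMap F (w.1.adicCompletion F) (p : F) ≠ 0 := by
        rwa [ne_eq, map_eq_zero]
      rw [map_div₀, div_eq_iff hp']
      have h2 := algebraMap_sum_ratCast_mul_basis p (fun i => (n i : ℚ)) w
      have h3 := hz w
      have h4 : ∀ i, (z i : ℚ_[p]) • completionFamily F p i w
          = (n i : ℚ_[p]) • completionFamily F p i w
            + padicToCompletion p w.1 w.2 (d i : ℚ_[p]) * completionFamily F p i w *
              algebraMap F (w.1.adicCompletion F) (p : F) := by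
        intro i
        have h5 : (z i : ℚ_[p]) = n i + p * d i := by
          have := congrArg (fun t : ℤ_[p] => (t : ℚ_[p])) (hd i)
          push_cast at this
          linear_combination this
        rw [h5, add_smul, Algebra.smul_def, Algebra.smul_def, map_mul, map_natCast,
          map_natCast]
        change _ + _ * padicToCompletion p w.1 w.2 (d i : ℚ_[p]) * _ = _
        ring
      rw [← algebraMap_sum_zsmul_basis, ← ha] at h2
      simp only [Rat.cast_intCast] at h2
      refine h2.trans ?_
      rw [neg_mul, eq_neg_iff_add_eq_zero, Finset.sum_mul, ← Finset.sum_add_distrib, ← h3]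
      refine Finset.sum_congr rfl fun i _ => ?_
      exact (h4 i).symm
    have h5 : Valued.v (algebraMap F (w.1.adicCompletion F) (algebraMap (𝓞 F) F a / p))
        = w.1.valuation F (algebraMap (𝓞 F) F a / p) :=
      HeightOneSpectrum.valuedAdicCompletion_eq_valuation' _ _
    rw [← h5, h1, Valuation.map_neg]
    refine Valuation.map_sum_le _ fun i _ => ?_
    rw [map_mul]
    refine mul_le_one' (valued_padicToCompletion_le_one p w.1 w.2 (d i)) ?_
    have h6 := HeightOneSpectrum.valuedAdicCompletion_eq_valuation (K := F) w.1 (RingOfIntegers.basis F i)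
    exact h6.trans_le (w.1.valuation_le_one _)
  have hval : ∀ v : HeightOneSpectrum (𝓞 F), v.valuation F (algebraMap (𝓞 F) F a / p) ≤ 1 := by
    intro v
    by_cases hv : (p : 𝓞 F) ∈ v.asIdeal
    · exact hover ⟨v, hv⟩
    · have h1 : v.valuation F (p : F) = 1 := by
        have := (v.valuation_eq_one_iff_notMem (K := F)).mpr hv
        simpa using this
      rw [map_div₀, h1, div_one]
      exact v.valuation_le_one a
  obtain ⟨b, hb⟩ := HeightOneSpectrum.mem_integers_of_valuation_le_one F (algebraMap (𝓞 F) F a / p) hval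
  have hab : a = (p : ℤ) • b := by
    apply RingOfIntegers.ext
    have : algebraMap (𝓞 F) F a = p * algebraMap (𝓞 F) F b := by rw [hb, mul_div_cancel₀ _ hp0]
    rw [zsmul_eq_mul, Int.cast_natCast]
    change algebraMap (𝓞 F) F a = algebraMap (𝓞 F) F (p * b)
    rw [this, map_mul, map_natCast]
  have hrepr := congrArg (fun t => (RingOfIntegers.basis F).repr t i₀) hab
  simp only [ha, map_smul, Finsupp.smul_apply, smul_eq_mul] at hrepr
  rw [Module.Basis.repr_sum_self] at hrepr
  have h7 : (p : ℤ_[p]) ∣ 1 := by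
    have h8 := hd i₀
    rw [hz₀, hrepr, pow_one] at h8
    refine ⟨d i₀ + ((RingOfIntegers.basis F).repr b i₀ : ℤ), ?_⟩
    push_cast at h8
    linear_combination h8
  exact PadicInt.prime_p.not_isUnit (isUnit_of_dvd_one h7)

variable (F) in
/-- The diagonal image of `F` in the product of the completions at the places above `p`. -/
def diagonalCompletion : F →+* ∀ v : PlacesOver F p, v.1.adicCompletion F :=
  RingHom.pi fun v => algebraMap F (v.1.adicCompletion F)

theorem diagonalCompletion_eq_sum (x : F) :
    diagonalCompletion F p x
      = ∑ i, (((integralBasis F).repr x i : ℚ) : ℚ_[p]) • completionFamily F p i := by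
  have h1 : x = ∑ i, (((integralBasis F).repr x i : ℚ) : F) *
      algebraMap (𝓞 F) F (RingOfIntegers.basis F i) := by
    conv_lhs => rw [← (integralBasis F).sum_repr x]
    refine Finset.sum_congr rfl fun i _ => ?_
    rw [integralBasis_apply, Rat.smul_def]
  funext v
  rw [Finset.sum_apply]
  conv_lhs => rw [h1]
  exact algebraMap_sum_ratCast_mul_basis p _ v

/-- The span is finite-dimensional, hence closed, and it contains the diagonal image of `F`, which
is dense by weak approximation. Finite-dimensionality of each completion over `ℚ_p` then follows. -/
theorem span_completionFamily : Submodule.span ℚ_[p] (Set.range (completionFamily F p)) = ⊤ := by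
  set W := Submodule.span ℚ_[p] (Set.range (completionFamily F p)) with hW
  have : FiniteDimensional ℚ_[p] W := FiniteDimensional.span_of_finite _ (Set.finite_range _)
  have hcl : IsClosed (W : Set (∀ v : PlacesOver F p, v.1.adicCompletion F)) :=
    W.closed_of_finiteDimensional
  have hd : DenseRange (diagonalCompletion F p) :=
    denseRange_algebraMap_pi _ Subtype.val_injective
  have hsub : Set.range (diagonalCompletion F p) ⊆ W := by
    rintro _ ⟨x, rfl⟩
    rw [diagonalCompletion_eq_sum]
    exact Submodule.sum_mem _ fun i _ => W.smul_mem _ (Submodule.subset_span ⟨i, rfl⟩)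
  rw [eq_top_iff]
  intro x _
  exact hcl.closure_subset_iff.mpr hsub (hd x)

variable (F) in
/-- An integral basis of `F` is a `ℚ_p`-basis of the product of the completions above `p`. -/
def completionBasis : Module.Basis (Module.Free.ChooseBasisIndex ℤ (𝓞 F)) ℚ_[p]
    (∀ v : PlacesOver F p, v.1.adicCompletion F) :=
  Module.Basis.mk (linearIndependent_completionFamily p) (span_completionFamily p).ge

instance : Module.Finite ℚ_[p] (∀ v : PlacesOver F p, v.1.adicCompletion F) :=
  .of_basis (completionBasis F p)

instance (v : PlacesOver F p) : Module.Finite ℚ_[p] (v.1.adicCompletion F) :=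
  .of_surjective (LinearMap.proj (φ := fun v : PlacesOver F p => v.1.adicCompletion F) v)
    (LinearMap.proj_surjective v)

/-- The global norm is the product of the local norms above `p`. -/
theorem norm_eq_prod_local_norm [Fintype (PlacesOver F p)] (x : F) :
    ((Algebra.norm ℚ x : ℚ) : ℚ_[p])
      = ∏ v : PlacesOver F p, Algebra.norm ℚ_[p] (algebraMap F (v.1.adicCompletion F) x) := by
  classical
  refine Eq.trans ?_ (norm_pi_eq_prod (K := ℚ_[p]) (diagonalCompletion F p x))
  -- Multiplication by `x` has the same rational matrix in the integral basis of `F` and in its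
  -- image in the product of completions.
  rw [Algebra.norm_eq_matrix_det (integralBasis F), Algebra.norm_eq_matrix_det (completionBasis F p)]
  refine (RingHom.map_det (Rat.castHom ℚ_[p]) _).trans ?_
  congr 1
  ext i j
  rw [RingHom.mapMatrix_apply, Matrix.map_apply, Algebra.leftMulMatrix_eq_repr_mul,
    Algebra.leftMulMatrix_eq_repr_mul]
  have h1 : completionBasis F p j = diagonalCompletion F p (integralBasis F j) := by
    rw [completionBasis, Module.Basis.mk_apply, integralBasis_apply]
    rfl
  have h2 : ∀ y : F, diagonalCompletion F p y
      = ∑ i, (((integralBasis F).repr y i : ℚ) : ℚ_[p]) • completionBasis F p i := by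
    intro y
    rw [diagonalCompletion_eq_sum]
    simp only [completionBasis, Module.Basis.mk_apply]
  rw [h1, ← map_mul, h2, Module.Basis.repr_sum_self]
  rfl

end LocalGlobal

/-! ### Degrees of places, the factors `λ_v`, and the product formula. -/

section Degrees

variable {F : Type*} [Field F] [NumberField F]

/-- The intersection embeds in the finite extension `L`. Finiteness matters because `finrank` is `0`
by convention in infinite dimension. -/
theorem localLogInertiaDeg_ne_zero (K L : Type*) [Field K] [Field L] [Algebra K L]
    [Module.Finite K L] : localLogInertiaDeg K L ≠ 0 := by
  let E := (IsScalarTower.toAlgHom K L (AlgebraicClosure L)).fieldRange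
  have : FiniteDimensional K E :=
    .of_surjective (IsScalarTower.toAlgHom K L (AlgebraicClosure L)).rangeRestrict.toLinearMap
      (AlgHom.rangeRestrict_surjective _)
  have h : E ⊓ cyclotomicZHat K (AlgebraicClosure L) ≤ E := inf_le_left
  have : FiniteDimensional K ↥(E ⊓ cyclotomicZHat K (AlgebraicClosure L)) :=
    .of_injective (IntermediateField.inclusion h).toLinearMap
      (IntermediateField.inclusion h).toRingHom.injective
  exact (Module.finrank_pos (R := K)
    (M := ↥(E ⊓ cyclotomicZHat K (AlgebraicClosure L)))).ne'

theorem localLogInertiaDeg_adicCompletion_ne_zero (p : ℕ) [Fact p.Prime] (v : PlacesOver F p) :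
    localLogInertiaDeg ℚ_[p] (v.1.adicCompletion F) ≠ 0 :=
  localLogInertiaDeg_ne_zero _ _

theorem logInertiaDeg_ne_zero (v : HeightOneSpectrum (𝓞 F)) : logInertiaDeg v ≠ 0 :=
  localLogInertiaDeg_adicCompletion_ne_zero (residueChar v) ⟨v, residueChar_mem v⟩

theorem residueChar_ne_of_notMem {n : ℕ} {v : HeightOneSpectrum (𝓞 F)} (hv : (n : 𝓞 F) ∉ v.asIdeal) :
    residueChar v ≠ n :=
  fun h => hv (h ▸ residueChar_mem v)

variable (ℓ : ℕ) [Fact ℓ.Prime]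

theorem placeDegree_ne_zero (v : HeightOneSpectrum (𝓞 F)) : placeDegree ℓ v ≠ 0 :=
  mul_ne_zero (by exact_mod_cast logInertiaDeg_ne_zero v)
    (rationalDegree_ne_zero ℓ _ Fact.out)

/-- Weighting by the degree removes the normalization, so the degree of a divisor is a sum of values
of `negLogAbs`. -/
theorem logVal_mul_placeDegree (v : HeightOneSpectrum (𝓞 F)) (x : LocalHat ℓ v) :
    logVal ℓ v x * placeDegree ℓ v = negLogAbs ℓ v x := by
  rw [logVal, LinearMap.smul_apply, smul_eq_mul, mul_right_comm,
    inv_mul_cancel₀ (placeDegree_ne_zero ℓ v), one_mul]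

theorem residueChar_pow_inertiaDeg (v : HeightOneSpectrum (𝓞 F)) :
    residueChar v ^ v.asIdeal.inertiaDeg ℤ = Ideal.absNorm v.asIdeal :=
  haveI := v.isPrime
  Ideal.absNorm_pow_inertiaDeg (v.asIdeal.under ℤ) v.asIdeal

theorem residueChar_eq_of_mem {v : HeightOneSpectrum (𝓞 F)} (hv : (ℓ : 𝓞 F) ∈ v.asIdeal) :
    residueChar v = ℓ := by
  by_contra h
  have hp : (residueChar v).Prime := Fact.out
  obtain ⟨a, b, hab⟩ := Nat.isCoprime_iff_coprime.mpr ((Nat.coprime_primes hp Fact.out).mpr h)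
  apply v.isPrime.ne_top
  rw [Ideal.eq_top_iff_one]
  have h1 : (a : 𝓞 F) * (residueChar v) + b * ℓ = 1 := by
    exact_mod_cast congrArg (Int.cast (R := 𝓞 F)) hab
  rw [← h1]
  exact v.asIdeal.add_mem (v.asIdeal.mul_mem_left _ (residueChar_mem v))
    (v.asIdeal.mul_mem_left _ hv)

theorem iwasawaLog_absNorm (v : HeightOneSpectrum (𝓞 F)) :
    iwasawaLog ℓ (Ideal.absNorm v.asIdeal : ℚ_[ℓ])
      = v.asIdeal.inertiaDeg ℤ * iwasawaLog ℓ (residueChar v : ℚ_[ℓ]) := by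
  rw [← residueChar_pow_inertiaDeg, Nat.cast_pow, iwasawaLog_pow]
  exact_mod_cast (Fact.out : (residueChar v).Prime).ne_zero

theorem iwasawaLog_absNorm_of_mem {v : HeightOneSpectrum (𝓞 F)} (hv : (ℓ : 𝓞 F) ∈ v.asIdeal) :
    iwasawaLog ℓ (Ideal.absNorm v.asIdeal : ℚ_[ℓ]) = 0 := by
  rw [iwasawaLog_absNorm, residueChar_eq_of_mem ℓ hv, iwasawaLog_self, mul_zero]

/-- The logarithmic inertia degree cancels: both sides are `f_v Log_ℓ p`. -/
theorem lambdaFactor_mul_placeDegree {v : HeightOneSpectrum (𝓞 F)} (hv : (ℓ : 𝓞 F) ∉ v.asIdeal) :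
    lambdaFactor ℓ v * placeDegree ℓ v = iwasawaLog ℓ (Ideal.absNorm v.asIdeal : ℚ_[ℓ]) := by
  have h : (logInertiaDeg v : ℚ_[ℓ]) ≠ 0 := by exact_mod_cast logInertiaDeg_ne_zero v
  rw [iwasawaLog_absNorm, lambdaFactor, placeDegree, rationalDegree,
    if_neg (residueChar_ne_of_notMem hv)]
  field_simp

theorem lambdaFactor_ne_zero (v : HeightOneSpectrum (𝓞 F)) : lambdaFactor ℓ v ≠ 0 := by
  have := v.isPrime
  refine div_ne_zero ?_ (by exact_mod_cast logInertiaDeg_ne_zero v)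
  exact_mod_cast (Ideal.inertiaDeg_pos v.asIdeal ℤ).ne'

theorem negLogAbs_of_notMem {v : HeightOneSpectrum (𝓞 F)} (hv : (ℓ : 𝓞 F) ∉ v.asIdeal)
    (x : LocalHat ℓ v) :
    negLogAbs ℓ v x = iwasawaLog ℓ (Ideal.absNorm v.asIdeal : ℚ_[ℓ]) * (ordHat ℓ v x : ℚ_[ℓ]) := by
  rw [negLogAbs, dif_neg hv]
  rfl

theorem logVal_of_notMem {v : HeightOneSpectrum (𝓞 F)} (hv : (ℓ : 𝓞 F) ∉ v.asIdeal)
    (x : LocalHat ℓ v) : logVal ℓ v x = lambdaFactor ℓ v * (ordHat ℓ v x : ℚ_[ℓ]) := by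
  apply mul_right_cancel₀ (placeDegree_ne_zero ℓ v)
  rw [logVal_mul_placeDegree, negLogAbs_of_notMem ℓ hv, mul_right_comm,
    lambdaFactor_mul_placeDegree ℓ hv]

/-- The negative of `Log_ℓ` of the local norm at a place above `ℓ`. -/
def negLogNorm (v : PlacesOver F ℓ) : Additive (v.1.adicCompletion F)ˣ →+ ℤ_[ℓ] :=
  -((iwasawaLogHom ℓ).comp (MonoidHom.toAdditive (localNorm ℓ v.1 v.2)))

theorem negLogNorm_apply (v : PlacesOver F ℓ) (x : Additive (v.1.adicCompletion F)ˣ) :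
    (negLogNorm ℓ v x : ℚ_[ℓ])
      = -iwasawaLog ℓ (Algebra.norm ℚ_[ℓ] (x.toMul : v.1.adicCompletion F)) := by
  rw [negLogNorm, AddMonoidHom.neg_apply, PadicInt.coe_neg]
  rfl

theorem negLogAbs_of_mem (v : PlacesOver F ℓ) (x : LocalHat ℓ v.1) :
    negLogAbs ℓ v.1 x = (Hat.extend ℓ (negLogNorm ℓ v) x : ℚ_[ℓ]) := by
  rw [negLogAbs, dif_pos v.2]
  rfl

theorem iwasawaLog_prod {ι : Type*} (s : Finset ι) (f : ι → ℚ_[ℓ]) (hf : ∀ i ∈ s, f i ≠ 0) :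
    iwasawaLog ℓ (∏ i ∈ s, f i) = ∑ i ∈ s, iwasawaLog ℓ (f i) := by
  classical
  induction s using Finset.induction_on with
  | empty => simp [iwasawaLog_one]
  | insert i s hi ih =>
    rw [Finset.prod_insert hi, Finset.sum_insert hi, iwasawaLog_mul, ih]
    · exact fun j hj => hf j (Finset.mem_insert_of_mem hj)
    · exact hf i (Finset.mem_insert_self i s)
    · exact Finset.prod_ne_zero_iff.mpr fun j hj => hf j (Finset.mem_insert_of_mem hj)

theorem finite_setOf_log_valuation_ne_zero (x : F) (hx : x ≠ 0) :
    {v : HeightOneSpectrum (𝓞 F) | WithZero.log (v.valuation F x) ≠ 0}.Finite := by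
  refine ((HeightOneSpectrum.Support.finite (𝓞 F) x).union
    (HeightOneSpectrum.Support.finite (𝓞 F) x⁻¹)).subset fun v hv => ?_
  by_contra h
  simp only [HeightOneSpectrum.Support, Set.mem_union, Set.mem_ofPred_eq, not_or, not_lt,
    map_inv₀] at h
  have h5 : v.valuation F x ≠ 0 := by rwa [Valuation.ne_zero_iff]
  have h6 : v.valuation F x = 1 :=
    le_antisymm h.1 ((inv_le_one₀ (zero_lt_iff.mpr h5)).mp h.2)
  exact hv (by rw [h6, WithZero.log_one])

theorem prod_absNorm_zpow_log (x : F) (hx : x ≠ 0) (T : Finset (HeightOneSpectrum (𝓞 F)))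
    (hT : ∀ v, WithZero.log (v.valuation F x) ≠ 0 → v ∈ T) :
    ∏ v ∈ T, (Ideal.absNorm v.asIdeal : ℚ) ^ WithZero.log (v.valuation F x)
      = |Algebra.norm ℚ x|⁻¹ := by
  have h := FinitePlace.prod_eq_inv_abs_norm hx
  rw [← finprod_comp_equiv FinitePlace.equivHeightOneSpectrum.symm] at h
  have h1 : ∀ v : HeightOneSpectrum (𝓞 F), (FinitePlace.equivHeightOneSpectrum.symm v) x
      = (Ideal.absNorm v.asIdeal : ℝ) ^ WithZero.log (v.valuation F x) := by
    intro v
    have h5 : v.valuation F x ≠ 0 := by rwa [Valuation.ne_zero_iff]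
    rw [FinitePlace.equivHeightOneSpectrum_symm_apply, FinitePlace.norm_embedding',
      WithZeroMulInt.toNNReal_neg_apply _ h5]
    generalize v.valuation F x = g at h5
    obtain ⟨n, rfl⟩ : ∃ n, g = WithZero.exp n := ⟨_, (WithZero.exp_log h5).symm⟩
    push_cast
    rfl
  simp_rw [h1] at h
  rw [finprod_eq_prod_of_mulSupport_subset (s := T)] at h
  -- The archimedean product formula is an identity between rational numbers; as such it can be
  -- moved into `ℚ_ℓ`.
  · apply Rat.cast_injective (α := ℝ)
    rw [← h, Rat.cast_prod]
    simp
  · intro v hv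
    refine hT v fun h0 => hv ?_
    simp only [h0, zpow_zero]

theorem localize_one_tmul {K L : Type*} [Field K] [Field L] [Algebra K L] (x : Kˣ) :
    localize ℓ (L := L) ((1 : ℤ_[ℓ]) ⊗ₜ[ℤ] Additive.ofMul x)
      = Hat.of ℓ (Additive Lˣ) (Additive.ofMul (Units.map (algebraMap K L : K →* L) x)) := by
  rw [localize, LinearMap.liftBaseChange_tmul, one_smul]
  rfl

theorem negLogAbs_localize_of_mem (v : PlacesOver F ℓ) (x : Fˣ) :
    negLogAbs ℓ v.1 (localize ℓ ((1 : ℤ_[ℓ]) ⊗ₜ[ℤ] Additive.ofMul x))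
      = -iwasawaLog ℓ (Algebra.norm ℚ_[ℓ] (algebraMap F (v.1.adicCompletion F) x)) := by
  rw [negLogAbs_of_mem, localize_one_tmul, Hat.extend_of, negLogNorm_apply]
  rfl

theorem negLogAbs_localize_of_notMem {v : HeightOneSpectrum (𝓞 F)} (hv : (ℓ : 𝓞 F) ∉ v.asIdeal)
    (x : Fˣ) :
    negLogAbs ℓ v (localize ℓ ((1 : ℤ_[ℓ]) ⊗ₜ[ℤ] Additive.ofMul x))
      = -(WithZero.log (v.valuation F (x : F)) * iwasawaLog ℓ (Ideal.absNorm v.asIdeal : ℚ_[ℓ])) := by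
  rw [negLogAbs_of_notMem ℓ hv, ordHat_localize_tmul, one_mul, PadicInt.coe_intCast]
  push_cast
  rw [toMul_ofMul]
  ring

open Classical in
/-- The product formula for the `ℓ`-adic absolute values. -/
theorem finsum_negLogAbs_localize (x : Fˣ) :
    ∑ᶠ v : HeightOneSpectrum (𝓞 F),
      negLogAbs ℓ v (localize ℓ ((1 : ℤ_[ℓ]) ⊗ₜ[ℤ] Additive.ofMul x)) = 0 := by
  have := Fintype.ofFinite (PlacesOver F ℓ)
  have hx : (x : F) ≠ 0 := x.ne_zero
  let T : Finset (HeightOneSpectrum (𝓞 F)) :=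
    (finite_setOf_log_valuation_ne_zero (x : F) hx).toFinset ∪ (finite_places_over ℓ).toFinset
  have hT : ∀ v : HeightOneSpectrum (𝓞 F), v ∈ T ↔
      WithZero.log (v.valuation F (x : F)) ≠ 0 ∨ (ℓ : 𝓞 F) ∈ v.asIdeal := by
    intro v
    simp [T]
  -- `G` may run over all places, because `Log_ℓ (N v) = 0` for `v ∣ ℓ`. Its sum is governed by the
  -- ordinary product formula, that of `H` by the local norms, and the two cancel.
  let G : HeightOneSpectrum (𝓞 F) → ℚ_[ℓ] := fun v =>
    WithZero.log (v.valuation F (x : F)) * iwasawaLog ℓ (Ideal.absNorm v.asIdeal : ℚ_[ℓ])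
  let h : PlacesOver F ℓ → ℚ_[ℓ] := fun v =>
    iwasawaLog ℓ (Algebra.norm ℚ_[ℓ] (algebraMap F (v.1.adicCompletion F) x))
  let H : HeightOneSpectrum (𝓞 F) → ℚ_[ℓ] := fun v =>
    if hv : (ℓ : 𝓞 F) ∈ v.asIdeal then h ⟨v, hv⟩ else 0
  have hGH : ∀ v, negLogAbs ℓ v (localize ℓ ((1 : ℤ_[ℓ]) ⊗ₜ[ℤ] Additive.ofMul x))
      = -(G v + H v) := by
    intro v
    by_cases hv : (ℓ : 𝓞 F) ∈ v.asIdeal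
    · simp only [G, H]
      rw [dif_pos hv, iwasawaLog_absNorm_of_mem ℓ hv, mul_zero, zero_add]
      exact negLogAbs_localize_of_mem ℓ ⟨v, hv⟩ x
    · simp only [G, H]
      rw [dif_neg hv, add_zero]
      exact negLogAbs_localize_of_notMem ℓ hv x
  have hN : (Algebra.norm ℚ (x : F) : ℚ) ≠ 0 := by rwa [Algebra.norm_ne_zero_iff]
  have hN' : ((Algebra.norm ℚ (x : F) : ℚ) : ℚ_[ℓ]) ≠ 0 := by exact_mod_cast hN
  have hG : ∑ v ∈ T, G v = -iwasawaLog ℓ ((Algebra.norm ℚ (x : F) : ℚ) : ℚ_[ℓ]) := by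
    have h0 : ∀ v : HeightOneSpectrum (𝓞 F), (Ideal.absNorm v.asIdeal : ℚ_[ℓ]) ≠ 0 := by
      intro v
      exact_mod_cast Ideal.absNorm_eq_zero_iff.not.mpr v.ne_bot
    have h1 := congrArg (fun t : ℚ => iwasawaLog ℓ (t : ℚ_[ℓ]))
      (prod_absNorm_zpow_log (x : F) hx T fun v hv => (hT v).mpr (Or.inl hv))
    simp only [Rat.cast_prod, Rat.cast_zpow, Rat.cast_natCast, Rat.cast_inv] at h1
    rw [iwasawaLog_prod _ _ _ fun v _ => zpow_ne_zero _ (h0 v)] at h1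
    simp only [iwasawaLog_zpow _ _ (h0 _)] at h1
    refine h1.trans ?_
    rcases abs_choice (Algebra.norm ℚ (x : F)) with h | h
    · rw [h, iwasawaLog_inv _ _ hN']
    · rw [h, Rat.cast_neg, iwasawaLog_inv _ _ (neg_ne_zero.mpr hN'), iwasawaLog_neg _ _ hN']
  have hH : ∑ v ∈ T, H v = iwasawaLog ℓ ((Algebra.norm ℚ (x : F) : ℚ) : ℚ_[ℓ]) := by
    rw [norm_eq_prod_local_norm, iwasawaLog_prod]
    · have h1 : ∑ v ∈ T with (ℓ : 𝓞 F) ∈ v.asIdeal, H v = ∑ v ∈ T, H v := by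
        refine Finset.sum_filter_of_ne fun v _ hv => ?_
        by_contra h
        exact hv (dif_neg h : H v = 0)
      rw [← h1, Finset.sum_subtype (p := fun v : HeightOneSpectrum (𝓞 F) => (ℓ : 𝓞 F) ∈ v.asIdeal)]
      · exact Finset.sum_congr rfl fun v _ => (dif_pos v.2 : H v.1 = h v)
      · intro v
        rw [Finset.mem_filter, hT]
        tauto
    · intro v _
      rw [Algebra.norm_ne_zero_iff]
      exact (map_ne_zero _).mpr hx
  rw [finsum_eq_sum_of_support_subset (s := T)]
  · simp only [hGH]
    rw [Finset.sum_neg_distrib, Finset.sum_add_distrib, hG, hH, neg_add_cancel, neg_zero]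
  · intro v hv
    rw [Finset.mem_coe, hT]
    by_contra! h
    refine hv ((hGH v).trans ?_)
    simp only [G, H]
    rw [dif_neg h.2, h.1, Int.cast_zero, zero_mul, add_zero, neg_zero]

theorem degree_principalDivisor (a : PrincipalIdeles F ℓ) :
    degree F ℓ (principalDivisor F ℓ a) = 0 := by
  induction a using TensorProduct.induction_on with
  | zero => rw [map_zero, map_zero]
  | add a b ha hb => rw [map_add, map_add, ha, hb, add_zero]
  | tmul c a =>
    have h : c ⊗ₜ[ℤ] a = c • ((1 : ℤ_[ℓ]) ⊗ₜ[ℤ] Additive.ofMul a.toMul) := by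
      rw [TensorProduct.smul_tmul', smul_eq_mul, mul_one]
      rfl
    rw [h, map_smul, map_smul]
    refine (congrArg (c • ·) ?_).trans (smul_zero c)
    refine Eq.trans ?_ (finsum_negLogAbs_localize ℓ a.toMul)
    exact finsum_congr fun v => logVal_mul_placeDegree ℓ v _

end Degrees

/-! ### Principal ideles realize all idelic logarithmic valuations above `ℓ`. -/

section SurjectivityAboveEll

variable {F : Type*} [Field F] [NumberField F] (ℓ : ℕ) [Fact ℓ.Prime]

theorem dvd_of_mem_span_pow_smul_top (n : ℕ) (y : ℤ_[ℓ])
    (h : y ∈ (Ideal.span {(ℓ : ℤ)} ^ n • ⊤ : Submodule ℤ ℤ_[ℓ])) : (ℓ : ℤ_[ℓ]) ^ n ∣ y := by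
  refine Submodule.smul_induction_on h (fun r hr z _ => ?_) fun x y hx hy => dvd_add hx hy
  rw [Ideal.span_singleton_pow, Ideal.mem_span_singleton] at hr
  obtain ⟨c, rfl⟩ := hr
  refine ⟨c * z, ?_⟩
  rw [zsmul_eq_mul]
  push_cast
  ring

/-- Modulo `ℓ ^ n` the extension depends only on the `n`-th component, which is represented by an
element of `A`. -/
theorem Hat.exists_dvd_extend_sub {A : Type*} [AddCommGroup A] (φ : A →+ ℤ_[ℓ]) (x : Hat ℓ A)
    (n : ℕ) : ∃ a : A, (ℓ : ℤ_[ℓ]) ^ n ∣ Hat.extend ℓ φ x - φ a := by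
  obtain ⟨a, ha⟩ := Submodule.Quotient.mk_surjective _ (Hat.coord ℓ n x)
  refine ⟨a, dvd_of_mem_span_pow_smul_top ℓ n _ ?_⟩
  have h := Hat.mk_extendFun ℓ φ x n
  rw [← ha] at h
  exact (Submodule.Quotient.eq _).mp h

theorem continuous_local_norm (v : PlacesOver F ℓ) :
    Continuous (Algebra.norm ℚ_[ℓ] : v.1.adicCompletion F → ℚ_[ℓ]) := by
  classical
  let b := Module.Free.chooseBasis ℚ_[ℓ] (v.1.adicCompletion F)
  have h1 : Continuous (Algebra.leftMulMatrix b).toLinearMap :=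
    LinearMap.continuous_of_finiteDimensional _
  have h2 : (Algebra.norm ℚ_[ℓ] : v.1.adicCompletion F → ℚ_[ℓ])
      = fun x => (Algebra.leftMulMatrix b x).det :=
    funext fun x => Algebra.norm_eq_matrix_det b x
  rw [h2]
  exact h1.matrix_det

theorem eventually_norm_iwasawaLog_sub_lt (v : PlacesOver F ℓ) (u : v.1.adicCompletion F)
    (hu : u ≠ 0) {ε : ℝ} (hε : 0 < ε) :
    ∀ᶠ x in 𝓝 u, x ≠ 0 ∧
      ‖iwasawaLog ℓ (Algebra.norm ℚ_[ℓ] x) - iwasawaLog ℓ (Algebra.norm ℚ_[ℓ] u)‖ < ε := by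
  have hc : ContinuousAt (fun x : v.1.adicCompletion F => iwasawaLog ℓ (Algebra.norm ℚ_[ℓ] x)) u :=
    ContinuousAt.comp (g := iwasawaLog ℓ)
      (continuousAt_iwasawaLog ℓ _ (Algebra.norm_ne_zero_iff.mpr hu))
      (continuous_local_norm ℓ v).continuousAt
  filter_upwards [isOpen_ne.mem_nhds hu, Metric.continuousAt_iff'.mp hc ε hε] with x h1 h2
  rw [dist_eq_norm] at h2
  exact ⟨h1, h2⟩

variable (F) in
/-- The values of `negLogNorm` at the places above `ℓ` on a principal idele. -/
def principalNegLogNorm : PrincipalIdeles F ℓ →ₗ[ℤ_[ℓ]] (PlacesOver F ℓ → ℤ_[ℓ]) :=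
  LinearMap.pi fun v => Hat.extend ℓ (negLogNorm ℓ v) ∘ₗ localize ℓ

/-- Weak approximation combined with continuity of `Log_ℓ` of the local norms. -/
theorem exists_dvd_sub_principalNegLogNorm (u : ∀ v : PlacesOver F ℓ, Additive (v.1.adicCompletion F)ˣ)
    (n : ℕ) : ∃ a : PrincipalIdeles F ℓ, ∀ v,
      (ℓ : ℤ_[ℓ]) ^ n ∣ negLogNorm ℓ v (u v) - principalNegLogNorm F ℓ a v := by
  have hε : (0 : ℝ) < (ℓ : ℝ) ^ (-(n : ℤ)) := zpow_pos (by exact_mod_cast (Fact.out : ℓ.Prime).pos) _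
  have hd : DenseRange (diagonalCompletion F ℓ) := denseRange_algebraMap_pi _ Subtype.val_injective
  have hev : ∀ᶠ f in 𝓝 (fun v => ((u v).toMul : v.1.adicCompletion F)), ∀ v : PlacesOver F ℓ,
      f v ≠ 0 ∧ ‖iwasawaLog ℓ (Algebra.norm ℚ_[ℓ] (f v))
        - iwasawaLog ℓ (Algebra.norm ℚ_[ℓ] ((u v).toMul : v.1.adicCompletion F))‖
          < (ℓ : ℝ) ^ (-(n : ℤ)) := by
    rw [eventually_all]
    intro v
    exact ((continuous_apply v).continuousAt (x := fun v => ((u v).toMul : v.1.adicCompletion F))).eventually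
      (eventually_norm_iwasawaLog_sub_lt ℓ v _ (u v).toMul.ne_zero hε)
  obtain ⟨a, ha⟩ := hd.exists_mem_open isOpen_interior ⟨_, mem_interior_iff_mem_nhds.mpr hev⟩
  replace ha := interior_subset ha
  by_cases ha0 : a = 0
  -- A place above `ℓ` would contradict `a = 0`, since the approximation is nonzero there; existence
  -- of such a place is thus not needed.
  · refine ⟨0, fun v => absurd ?_ (ha v).1⟩
    rw [ha0, map_zero]
    rfl
  · refine ⟨1 ⊗ₜ Additive.ofMul (Units.mk0 a ha0), fun v => ?_⟩
    rw [← Ideal.mem_span_singleton, ← PadicInt.norm_le_pow_iff_mem_span_pow]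
    refine le_trans (le_of_eq ?_) (ha v).2.le
    change ‖((negLogNorm ℓ v (u v) - Hat.extend ℓ (negLogNorm ℓ v) (localize ℓ _) : ℤ_[ℓ]) : ℚ_[ℓ])‖ = _
    rw [localize_one_tmul, Hat.extend_of, PadicInt.coe_sub, negLogNorm_apply, negLogNorm_apply,
      neg_sub_neg]
    rfl

theorem exists_principalNegLogNorm_eq (x : ∀ v : PlacesOver F ℓ, LocalHat ℓ v.1) :
    ∃ a : PrincipalIdeles F ℓ, ∀ v,
      principalNegLogNorm F ℓ a v = Hat.extend ℓ (negLogNorm ℓ v) (x v) := by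
  let y : PlacesOver F ℓ → ℤ_[ℓ] := fun v => Hat.extend ℓ (negLogNorm ℓ v) (x v)
  let R := (principalNegLogNorm F ℓ).range
  suffices h : R.mkQ y = 0 by
    rw [Submodule.mkQ_apply, Submodule.Quotient.mk_eq_zero] at h
    obtain ⟨a, ha⟩ := h
    exact ⟨a, fun v => congrFun ha v⟩
  have hI : Ideal.span {(ℓ : ℤ_[ℓ])} ≠ ⊤ := by
    rw [ne_eq, Ideal.span_singleton_eq_top]
    exact PadicInt.prime_p.not_isUnit
  -- Krull's intersection theorem for the finitely generated quotient by `R`: it suffices that the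
  -- class of `y` is divisible by every `ℓ ^ n`.
  rw [← Submodule.mem_bot ℤ_[ℓ], ← Ideal.iInf_pow_smul_eq_bot_of_isLocalRing _ hI,
    Submodule.mem_iInf]
  intro n
  choose u hu using fun v => Hat.exists_dvd_extend_sub ℓ (negLogNorm ℓ v) (x v) n
  obtain ⟨a, ha⟩ := exists_dvd_sub_principalNegLogNorm ℓ u n
  choose z hz using fun v => dvd_add (hu v) (ha v)
  have h1 : y = principalNegLogNorm F ℓ a + (ℓ : ℤ_[ℓ]) ^ n • z := by
    funext v
    have := hz v
    rw [Pi.add_apply, Pi.smul_apply, smul_eq_mul]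
    simp only [y]
    linear_combination this
  have h2 : R.mkQ (principalNegLogNorm F ℓ a) = 0 := by
    rw [Submodule.mkQ_apply, Submodule.Quotient.mk_eq_zero]
    exact ⟨a, rfl⟩
  rw [h1, map_add, h2, zero_add, map_smul]
  exact Submodule.smul_mem_smul (Ideal.pow_mem_pow (Ideal.mem_span_singleton_self _) n)
    Submodule.mem_top

theorem exists_principalLogVal_eq (x : Ideles F ℓ) :
    ∃ a : PrincipalIdeles F ℓ, ∀ v : HeightOneSpectrum (𝓞 F), (ℓ : 𝓞 F) ∈ v.asIdeal →
      logVal ℓ v (localize ℓ a) = logVal ℓ v (x.1 v) := by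
  obtain ⟨a, ha⟩ := exists_principalNegLogNorm_eq ℓ fun v : PlacesOver F ℓ => x.1 v.1
  refine ⟨a, fun v hv => ?_⟩
  apply mul_right_cancel₀ (placeDegree_ne_zero ℓ v)
  rw [logVal_mul_placeDegree, logVal_mul_placeDegree]
  refine (negLogAbs_of_mem ℓ ⟨v, hv⟩ _).trans (Eq.trans ?_ (negLogAbs_of_mem ℓ ⟨v, hv⟩ _).symm)
  exact congrArg _ (ha ⟨v, hv⟩)

end SurjectivityAboveEll

theorem finite_setOf_exponent_ne_zero {K : Type*} [Field K] (ℓ : ℕ) [Fact ℓ.Prime]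
    (α : EllIdeals K ℓ) : {v | exponent K ℓ v α ≠ 0}.Finite :=
  Finsupp.hasFiniteSupport (M := ℤ_[ℓ]) α

/-! ### Comparison of `ℓ`-ideals with logarithmic divisors, and the induced isomorphism. -/

section Comparison

variable {F : Type*} [Field F] [NumberField F] (ℓ : ℕ) [Fact ℓ.Prime]

/-- The idelic logarithmic units are exactly the common kernel of the logarithmic valuations, so the
infinite components play no role. -/
theorem logDivisor_eq_of_forall_divisorLogVal_eq {d e : LogDivisors F ℓ}
    (h : ∀ v, divisorLogVal ℓ v d = divisorLogVal ℓ v e) : d = e := by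
  rw [← sub_eq_zero]
  obtain ⟨x, hx⟩ := Submodule.mkQ_surjective _ (d - e)
  rw [← hx, Submodule.mkQ_apply, Submodule.Quotient.mk_eq_zero]
  intro v
  have h1 : divisorLogVal ℓ v (d - e) = 0 := by rw [map_sub, h, sub_self]
  rw [← hx] at h1
  exact h1

/-- A uniformizer can be taken in `F` itself. Its choice does not affect divisors, which off `ℓ` see
only the valuation. -/
theorem exists_ordHat_eq_one (v : HeightOneSpectrum (𝓞 F)) : ∃ x : LocalHat ℓ v, ordHat ℓ v x = 1 := by
  obtain ⟨ϖ, hϖ⟩ := v.valuation_exists_uniformizer F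
  have h0 : ϖ ≠ 0 := by
    rintro rfl
    rw [map_zero] at hϖ
    exact WithZero.exp_ne_zero hϖ.symm
  refine ⟨localize ℓ ((1 : ℤ_[ℓ]) ⊗ₜ[ℤ] Additive.ofMul (Units.mk0 ϖ h0)), ?_⟩
  rw [ordHat_localize_tmul, toMul_ofMul, Units.val_mk0, hϖ]
  simp

/-- An element of `R_v` with valuation `1`. -/
def uniformizerHat (v : HeightOneSpectrum (𝓞 F)) : LocalHat ℓ v :=
  (exists_ordHat_eq_one ℓ v).choose

theorem ordHat_uniformizerHat (v : HeightOneSpectrum (𝓞 F)) : ordHat ℓ v (uniformizerHat ℓ v) = 1 :=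
  (exists_ordHat_eq_one ℓ v).choose_spec

open Classical in
/-- The component at `v` of an idele which represents an `ℓ`-ideal. -/
def ellIdealComponent (v : HeightOneSpectrum (𝓞 F)) : EllIdeals F ℓ →ₗ[ℤ_[ℓ]] LocalHat ℓ v :=
  if hv : (ℓ : 𝓞 F) ∈ v.asIdeal then 0
  else (LinearMap.toSpanSingleton ℤ_[ℓ] _ (uniformizerHat ℓ v)) ∘ₗ exponent F ℓ ⟨v, hv⟩

theorem ellIdealComponent_of_mem {v : HeightOneSpectrum (𝓞 F)} (hv : (ℓ : 𝓞 F) ∈ v.asIdeal)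
    (α : EllIdeals F ℓ) : ellIdealComponent ℓ v α = 0 := by
  rw [ellIdealComponent, dif_pos hv, LinearMap.zero_apply]

theorem ordHat_ellIdealComponent {v : HeightOneSpectrum (𝓞 F)} (hv : (ℓ : 𝓞 F) ∉ v.asIdeal)
    (α : EllIdeals F ℓ) : ordHat ℓ v (ellIdealComponent ℓ v α) = exponent F ℓ ⟨v, hv⟩ α := by
  rw [ellIdealComponent, dif_neg hv, LinearMap.comp_apply, LinearMap.toSpanSingleton_apply, map_smul,
    ordHat_uniformizerHat, smul_eq_mul, mul_one]

theorem eventually_ellIdealComponent_mem (α : EllIdeals F ℓ) :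
    ∀ᶠ v : HeightOneSpectrum (𝓞 F) in cofinite, ellIdealComponent ℓ v α ∈ (ordHat ℓ v).ker := by
  refine ((finite_setOf_exponent_ne_zero ℓ α).image Subtype.val).subset fun v hv => ?_
  by_cases h : (ℓ : 𝓞 F) ∈ v.asIdeal
  · refine absurd ?_ hv
    change ellIdealComponent ℓ v α ∈ (ordHat ℓ v).ker
    rw [ellIdealComponent_of_mem ℓ h]
    exact zero_mem _
  · refine ⟨⟨v, h⟩, fun h0 => hv ?_, rfl⟩
    change ellIdealComponent ℓ v α ∈ (ordHat ℓ v).ker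
    rw [LinearMap.mem_ker, ordHat_ellIdealComponent ℓ h, h0]

variable (F)

/-- An idele which represents an `ℓ`-ideal. -/
def ellIdealIdele : EllIdeals F ℓ →ₗ[ℤ_[ℓ]] Ideles F ℓ where
  toFun α := (⟨fun v => ellIdealComponent ℓ v α, eventually_ellIdealComponent_mem ℓ α⟩, 0)
  map_add' α β := by
    refine Prod.ext (RestrictedProduct.ext _ _ fun v => ?_) (add_zero _).symm
    exact map_add (ellIdealComponent ℓ v) α β
  map_smul' c α := by
    refine Prod.ext (RestrictedProduct.ext _ _ fun v => ?_) (smul_zero c).symm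
    exact map_smul (ellIdealComponent ℓ v) c α

/-- The logarithmic divisor `∑ λ_v α_v v` attached to an `ℓ`-ideal `∏ v ^ (α_v)`. -/
def ellIdealDivisor : EllIdeals F ℓ →ₗ[ℤ_[ℓ]] LogDivisors F ℓ :=
  (logUnits F ℓ).mkQ ∘ₗ ellIdealIdele F ℓ

variable {F}

theorem divisorLogVal_ellIdealDivisor_of_mem {v : HeightOneSpectrum (𝓞 F)}
    (hv : (ℓ : 𝓞 F) ∈ v.asIdeal) (α : EllIdeals F ℓ) :
    divisorLogVal ℓ v (ellIdealDivisor F ℓ α) = 0 := by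
  change logVal ℓ v (ellIdealComponent ℓ v α) = 0
  rw [ellIdealComponent_of_mem ℓ hv, map_zero]

theorem divisorLogVal_ellIdealDivisor_of_notMem {v : HeightOneSpectrum (𝓞 F)}
    (hv : (ℓ : 𝓞 F) ∉ v.asIdeal) (α : EllIdeals F ℓ) :
    divisorLogVal ℓ v (ellIdealDivisor F ℓ α)
      = lambdaFactor ℓ v * (exponent F ℓ ⟨v, hv⟩ α : ℚ_[ℓ]) := by
  change logVal ℓ v (ellIdealComponent ℓ v α) = _
  rw [logVal_of_notMem ℓ hv, ordHat_ellIdealComponent ℓ hv]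

theorem degree_ellIdealDivisor (α : EllIdeals F ℓ) :
    degree F ℓ (ellIdealDivisor F ℓ α) = ellIdealDegree F ℓ α := by
  let s := (finite_setOf_exponent_ne_zero ℓ α).toFinset
  have h1 : degree F ℓ (ellIdealDivisor F ℓ α)
      = ∑ v ∈ s.map ⟨Subtype.val, Subtype.val_injective⟩,
        divisorLogVal ℓ v (ellIdealDivisor F ℓ α) * placeDegree ℓ v := by
    refine finsum_eq_sum_of_support_subset _ fun v hv => ?_
    replace hv := left_ne_zero_of_mul hv
    have h : (ℓ : 𝓞 F) ∉ v.asIdeal :=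
      fun h => hv (divisorLogVal_ellIdealDivisor_of_mem ℓ h α)
    rw [divisorLogVal_ellIdealDivisor_of_notMem ℓ h] at hv
    refine Finset.mem_coe.mpr (Finset.mem_map.mpr ⟨⟨v, h⟩, ?_, rfl⟩)
    rw [Set.Finite.mem_toFinset]
    exact fun h0 => right_ne_zero_of_mul hv (by rw [h0, PadicInt.coe_zero])
  have h2 : ellIdealDegree F ℓ α = ∑ v ∈ s,
      lambdaFactor ℓ v.1 * placeDegree ℓ v.1 * (exponent F ℓ v α : ℚ_[ℓ]) :=
    Finset.sum_congr (by
      ext v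
      rw [Set.Finite.mem_toFinset]
      exact Finsupp.mem_support_iff) fun v _ => rfl
  rw [h1, h2, Finset.sum_map]
  refine Finset.sum_congr rfl fun v _ => ?_
  refine (congrArg (· * _) (divisorLogVal_ellIdealDivisor_of_notMem ℓ v.2 α)).trans ?_
  exact mul_right_comm _ _ _

/-- Coefficients are compared place by place; off `ℓ` both are multiples of `λ_v`, which is
cancelled. -/
theorem principalDivisor_eq_ellIdealDivisor_iff (a : PrincipalIdeles F ℓ) (α : EllIdeals F ℓ) :
    principalDivisor F ℓ a = ellIdealDivisor F ℓ α ↔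
      (∀ v : HeightOneSpectrum (𝓞 F), (ℓ : 𝓞 F) ∈ v.asIdeal → principalLogVal ℓ v a = 0) ∧
      ∀ v, exponent F ℓ v α = principalVal ℓ v.1 a := by
  have h1 : ∀ v : HeightOneSpectrum (𝓞 F),
      divisorLogVal ℓ v (principalDivisor F ℓ a) = principalLogVal ℓ v a := fun v => rfl
  have h2 : ∀ v : HeightOneSpectrum (𝓞 F), (ℓ : 𝓞 F) ∉ v.asIdeal →
      principalLogVal ℓ v a = lambdaFactor ℓ v * (principalVal ℓ v a : ℚ_[ℓ]) :=
    fun v hv => logVal_of_notMem ℓ hv _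
  constructor
  · intro h
    refine ⟨fun v hv => ?_, fun v => ?_⟩
    · rw [← h1, h, divisorLogVal_ellIdealDivisor_of_mem ℓ hv]
    · apply Subtype.ext
      apply mul_left_cancel₀ (lambdaFactor_ne_zero ℓ v.1)
      rw [← divisorLogVal_ellIdealDivisor_of_notMem ℓ v.2, ← h2 _ v.2, ← h, h1]
  · rintro ⟨h3, h4⟩
    refine logDivisor_eq_of_forall_divisorLogVal_eq ℓ fun v => ?_
    rw [h1]
    by_cases hv : (ℓ : 𝓞 F) ∈ v.asIdeal
    · rw [h3 v hv, divisorLogVal_ellIdealDivisor_of_mem ℓ hv]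
    · rw [h2 v hv, divisorLogVal_ellIdealDivisor_of_notMem ℓ hv, h4 ⟨v, hv⟩]

theorem mem_principalEllIdeals_iff (α : EllIdeals F ℓ) :
    α ∈ PrincipalEllIdeals F ℓ ↔ ellIdealDivisor F ℓ α ∈ PrincipalLogDivisors F ℓ :=
  exists_congr fun a => (principalDivisor_eq_ellIdealDivisor_iff ℓ a α).symm

/-- After division by a principal idele matching it above `ℓ`, an idele has a divisor supported off
`ℓ`. There the coefficients are `λ_v` times `ℓ`-adic integers, so they come from an `ℓ`-ideal. -/
theorem exists_ellIdealDivisor_add_principalDivisor_eq (d : LogDivisors F ℓ) :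
    ∃ (α : EllIdeals F ℓ) (a : PrincipalIdeles F ℓ),
      ellIdealDivisor F ℓ α + principalDivisor F ℓ a = d := by
  classical
  obtain ⟨x, rfl⟩ := Submodule.mkQ_surjective _ d
  obtain ⟨a, ha⟩ := exists_principalLogVal_eq ℓ x
  let z : Ideles F ℓ := x - principalIdele F ℓ a
  have hz : {v | ¬ z.1 v ∈ (ordHat ℓ v).ker}.Finite := z.1.2
  -- The support is finite because `z` belongs to the restricted product with respect to the unit
  -- subgroups.
  let α : EllIdeals F ℓ := Finsupp.ofSupportFinite
    (fun v : {v : HeightOneSpectrum (𝓞 F) // (ℓ : 𝓞 F) ∉ v.asIdeal} => ordHat ℓ v.1 (z.1 v.1))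
    ((hz.preimage Subtype.val_injective.injOn).subset fun v hv => hv)
  have hα : ∀ v, exponent F ℓ v α = ordHat ℓ v.1 (z.1 v.1) := fun v => rfl
  refine ⟨α, a, ?_⟩
  rw [← eq_sub_iff_add_eq]
  have hd : (logUnits F ℓ).mkQ x - principalDivisor F ℓ a = (logUnits F ℓ).mkQ z :=
    (map_sub (logUnits F ℓ).mkQ x (principalIdele F ℓ a)).symm
  rw [hd]
  refine logDivisor_eq_of_forall_divisorLogVal_eq ℓ fun v => ?_
  have h1 : divisorLogVal ℓ v ((logUnits F ℓ).mkQ z) = logVal ℓ v (z.1 v) := rfl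
  rw [h1]
  by_cases hv : (ℓ : 𝓞 F) ∈ v.asIdeal
  · rw [divisorLogVal_ellIdealDivisor_of_mem ℓ hv]
    have h2 : z.1 v = x.1 v - localize ℓ a := rfl
    rw [h2, map_sub, ha v hv, sub_self]
  · rw [divisorLogVal_ellIdealDivisor_of_notMem ℓ hv, hα, logVal_of_notMem ℓ hv]

variable (F)

/-- The map from `ℓ`-ideals of logarithmic degree zero to logarithmic classes. -/
def ellIdealToLogClass : EllIdealsZero F ℓ →ₗ[ℤ_[ℓ]] LogClassGroup F ℓ :=
  ((PrincipalLogDivisors F ℓ).submoduleOf (LogDivisorsZero F ℓ)).mkQ ∘ₗ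
    (ellIdealDivisor F ℓ).restrict (p := EllIdealsZero F ℓ) (q := LogDivisorsZero F ℓ) fun α hα => by
      rw [LinearMap.mem_ker, degree_ellIdealDivisor]
      exact hα

theorem ker_ellIdealToLogClass :
    (ellIdealToLogClass F ℓ).ker = (PrincipalEllIdeals F ℓ).submoduleOf (EllIdealsZero F ℓ) := by
  ext α
  rw [LinearMap.mem_ker, ellIdealToLogClass, LinearMap.comp_apply, Submodule.mkQ_apply,
    Submodule.Quotient.mk_eq_zero]
  exact (mem_principalEllIdeals_iff ℓ α.1).symm

/-- The `ℓ`-ideal obtained by clearing a degree zero divisor above `ℓ` has degree zero again, since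
principal divisors do. -/
theorem ellIdealToLogClass_surjective : Function.Surjective (ellIdealToLogClass F ℓ) := by
  intro c
  obtain ⟨d, rfl⟩ := Submodule.Quotient.mk_surjective _ c
  obtain ⟨α, a, h⟩ := exists_ellIdealDivisor_add_principalDivisor_eq ℓ d.1
  have hα : α ∈ EllIdealsZero F ℓ := by
    have h1 := congrArg (degree F ℓ) h
    rw [map_add, degree_principalDivisor, add_zero, degree_ellIdealDivisor] at h1
    exact h1.trans d.2
  refine ⟨⟨α, hα⟩, (Submodule.Quotient.eq _).mpr ?_⟩
  refine ⟨-a, ?_⟩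
  rw [map_neg]
  change -principalDivisor F ℓ a = ellIdealDivisor F ℓ α - d.1
  rw [← h]
  abel

/-- The logarithmic class group as a quotient of the group of `ℓ`-ideals. -/
def logClassGroupEquiv : LogClassGroup F ℓ ≃ₗ[ℤ_[ℓ]] EllIdealClassGroup F ℓ :=
  ((Submodule.quotEquivOfEq _ _ (ker_ellIdealToLogClass F ℓ).symm).trans
    ((ellIdealToLogClass F ℓ).quotKerEquivOfSurjective (ellIdealToLogClass_surjective F ℓ))).symm

theorem logClassGroupEquiv_ellIdealToLogClass (α : EllIdealsZero F ℓ) :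
    logClassGroupEquiv F ℓ (ellIdealToLogClass F ℓ α) = Submodule.Quotient.mk α :=
  (LinearEquiv.symm_apply_eq _).mpr rfl

end Comparison

end LogClass

end

theorem mainTheorem3 (F : Type*) [Field F] [NumberField F] (ℓ : ℕ) [Fact ℓ.Prime] :
    LogClass.PrincipalLogDivisors F ℓ ≤ LogClass.LogDivisorsZero F ℓ ∧
    LogClass.PrincipalEllIdeals F ℓ ≤ LogClass.EllIdealsZero F ℓ ∧
    ∃ e : LogClass.LogClassGroup F ℓ ≃ₗ[ℤ_[ℓ]]
        LogClass.EllIdealClassGroup F ℓ,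
      ∀ α : LogClass.EllIdealsZero F ℓ, ∃ d : LogClass.LogDivisorsZero F ℓ,
        (∀ v : {v : HeightOneSpectrum (𝓞 F) // (ℓ : 𝓞 F) ∉ v.asIdeal},
          LogClass.divisorLogVal ℓ v.1 d.1 =
            LogClass.lambdaFactor ℓ v.1 * (LogClass.exponent F ℓ v α.1 : ℚ_[ℓ])) ∧
        (∀ v : HeightOneSpectrum (𝓞 F), (ℓ : 𝓞 F) ∈ v.asIdeal →
          LogClass.divisorLogVal ℓ v d.1 = 0) ∧
        e (Submodule.Quotient.mk d) = Submodule.Quotient.mk α := by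
  have hPl : LogClass.PrincipalLogDivisors F ℓ ≤ LogClass.LogDivisorsZero F ℓ := by
    rintro _ ⟨a, rfl⟩
    exact LogClass.degree_principalDivisor ℓ a
  refine ⟨hPl, fun α hα => ?_, LogClass.logClassGroupEquiv F ℓ, fun α => ?_⟩
  -- The inclusion for ideals is the one for divisors, pulled back along `ellIdealDivisor`.
  · rw [LinearMap.mem_ker, ← LogClass.degree_ellIdealDivisor]
    exact hPl ((LogClass.mem_principalEllIdeals_iff ℓ α).mp hα)
  · refine ⟨⟨LogClass.ellIdealDivisor F ℓ α.1, ?_⟩, fun v => ?_, fun v hv => ?_, ?_⟩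
    · rw [LinearMap.mem_ker, LogClass.degree_ellIdealDivisor]
      exact α.2
    · exact LogClass.divisorLogVal_ellIdealDivisor_of_notMem ℓ v.2 α.1
    · exact LogClass.divisorLogVal_ellIdealDivisor_of_mem ℓ hv α.1
    · exact LogClass.logClassGroupEquiv_ellIdealToLogClass F ℓ α
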